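/- Let $n\ge 1$, let $\beta>0$ and $R>0$, and let $p>1$ be arbitrary if $n=1$ and satisfy $1<p<p_{\mathrm{Str}}(n)$ if $n\ge 2$, where $p_{\mathrm{Str}}(n)$ is the positive root of $(n-1)q^2-(n+1)q-2=0$. Let $(u_0,u_1,u_2)\in H^2(\mathbb{R}^n)\times H^1(\mathbb{R}^n)\times L^2(\mathbb{R}^n)$ be (real-valued and) nonnegative almost everywhere, with supports contained in the ball $B_R$ of radius $R$ around the origin, and let $u_0$ not vanish identically. For $\varepsilon>0$ consider the Cauchy problem $$\beta u_{ttt}+u_{tt}-\Delta u-\beta\Delta u_t=|u|^p\quad (t>0,\ x\in\mathbb{R}^n),\qquad (u,u_t,u_{tt})(0,\cdot)=\varepsilon(u_0,u_1,u_2).\tag{1}$$ For $0<T\le\infty$, an energy solution of (1) on $[0,T)$ is a function $$u\in C([0,T),H^2(\mathbb{R}^n))\cap C^1([0,T),H^1(\mathbb{R}^n))\cap C^2([0,T),L^2(\mathbb{R}^n))\cap L^p_{\mathrm{loc}}([0,T)\times\mathbb{R}^n)$$ with $u(0)=\varepsilon u_0$ in $H^2$, $u_t(0)=\varepsilon u_1$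 in $H^1$, $u_{tt}(0)=\varepsilon u_2$ in $L^2$, such that for all $\psi\in C_0^\infty([0,T)\times\mathbb{R}^n)$ and all $t\in[0,T)$ $$\begin{aligned}&\beta\int_{\mathbb{R}^n}u_{tt}(t,x)\psi(t,x)\,dx+\int_{\mathbb{R}^n}u_t(t,x)\psi(t,x)\,dx-\beta\varepsilon\int_{\mathbb{R}^n}u_2(x)\psi(0,x)\,dx-\varepsilon\int_{\mathbb{R}^n}u_1(x)\psi(0,x)\,dx\\&+\beta\int_0^t\!\int_{\mathbb{R}^n}\big(\nabla u_t\cdot\nabla\psi-u_{tt}\psi_s\big)(s,x)\,dx\,ds+\int_0^t\!\int_{\mathbb{R}^n}\big(\nabla u\cdot\nabla\psi-u_t\psi_s\big)(s,x)\,dx\,ds=\int_0^t\!\int_{\mathbb{R}^n}|u(s,x)|^p\psi(s,x)\,dx\,ds.\end{aligned}$$ We consider energy solutions that satisfy $$\operatorname{supp}u(t,\cdot)\subset B_{R+t}\quad\text{for all }t\in(0,T).\tag{2}$$ The lifespan $T(\varepsilon)\in[T,\infty]$ of such a solution $u$ is the supremum of all $S\ge T$ such that $u$ extends to an energy solution on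 $[0,S)$ satisfying (2) with $S$ in place of $T$; $u$ blows up in finite time if $T(\varepsilon)<\infty$. Then there are constants $\varepsilon_0>0$ and $C>0$, depending only on $u_0,u_1,u_2,n,p,R,\beta$, such that for every $\varepsilon\in(0,\varepsilon_0]$ every energy solution $u$ of (1) on some $[0,T)$ that satisfies (2) blows up in finite time, and its lifespan satisfies $$T(\varepsilon)\le C\,\varepsilon^{-\frac{2p(p-1)}{\theta(p,n)}},\qquad \theta(p,n)=2+(n+1)p-(n-1)p^2.$$ -/

import Mathlib

open MeasureTheory Set
open scoped ENNReal ContDiff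

namespace MGT

/-- Euclidean space `ℝⁿ`. -/
abbrev Space (n : ℕ) : Type := EuclideanSpace ℝ (Fin n)

/-- The real Hilbert space `L²(ℝⁿ)`. -/
abbrev L2 (n : ℕ) : Type := Lp ℝ 2 (volume : Measure (Space n))

/-- The `i`-th standard basis vector of `ℝⁿ`. -/
noncomputable def e {n : ℕ} (i : Fin n) : Space n := EuclideanSpace.single i 1

/-- `g` is the weak derivative `∂_{α 0} ⋯ ∂_{α (j-1)} f` of order `j`:
`∫ f ∂^α φ = (-1)^j ∫ g φ` for all smooth compactly supported `φ`. -/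
def IsWeakDeriv {n j : ℕ} (α : Fin j → Fin n) (f g : Space n → ℝ) : Prop :=
  ∀ φ : Space n → ℝ, ContDiff ℝ ∞ φ → HasCompactSupport φ →
    ∫ x, f x * iteratedFDeriv ℝ j φ x (fun i => e (α i)) = (-1) ^ j * ∫ x, g x * φ x

/-- All sequences of at most `k` coordinate directions: the partial derivatives of order `≤ k`. -/
abbrev DerivIndex (n k : ℕ) : Type := Σ j : Fin (k + 1), (Fin j → Fin n)

/-- The index of the derivative of order zero. -/
def noDeriv (n k : ℕ) : DerivIndex n k := ⟨0, fun i => i.elim0⟩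

theorem integrable_mul_of_test {n : ℕ} (f : L2 n) {φ : Space n → ℝ} (h : Continuous φ)
    (hc : HasCompactSupport φ) : Integrable (fun x => f x * φ x) :=
  by
  have h2 : MemLp φ 2 (volume : Measure (Space n)) := h.memLp_of_hasCompactSupport hc
  exact (Lp.memLp f).integrable_mul h2

theorem integrable_mul_iteratedFDeriv {n j : ℕ} (f : L2 n) {φ : Space n → ℝ}
    (h : ContDiff ℝ ∞ φ) (hc : HasCompactSupport φ) (v : Fin j → Space n) :
    Integrable (fun x => f x * iteratedFDeriv ℝ j φ x v) := by
  have h1 : Continuous (iteratedFDeriv ℝ j φ) :=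
    h.continuous_iteratedFDeriv (by exact_mod_cast le_top)
  refine integrable_mul_of_test f (φ := fun x => iteratedFDeriv ℝ j φ x v) (by fun_prop) ?_
  exact (hc.iteratedFDeriv (𝕜 := ℝ) j).comp_left (g := fun A => A v) rfl

/-- The Sobolev space `H^k(ℝⁿ)`: an element is a family in `L²` consisting of a function together
with all its weak partial derivatives of order `≤ k`; the norm it inherits is
`(∑_{j ≤ k} ‖∇^j f‖²_{L²})^{1/2}`. -/
noncomputable def Sobolev (n k : ℕ) : Submodule ℝ (PiLp 2 fun _ : DerivIndex n k => L2 n) where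
  carrier := {F | ∀ a : DerivIndex n k, IsWeakDeriv a.2 (F (noDeriv n k)) (F a)}
  zero_mem' := by
    intro a φ _ _
    have h0 : (((0 : L2 n)) : Space n → ℝ) =ᵐ[volume] 0 := Lp.coeFn_zero _ _ _
    rw [integral_eq_zero_of_ae, integral_eq_zero_of_ae, mul_zero]
    · filter_upwards [h0] with x hx
      rw [Pi.zero_apply]
      exact mul_eq_zero_of_left hx _
    · filter_upwards [h0] with x hx
      rw [Pi.zero_apply]
      exact mul_eq_zero_of_left hx _
  add_mem' := by
    intro F G hF hG a φ hφ hc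
    have key : ∀ (f g : L2 n) (ψ : Space n → ℝ), Integrable (fun x => f x * ψ x) →
        Integrable (fun x => g x * ψ x) →
        ∫ x, (f + g) x * ψ x = (∫ x, f x * ψ x) + ∫ x, g x * ψ x := by
      intro f g ψ h1 h2
      rw [← integral_add h1 h2]
      refine integral_congr_ae ?_
      filter_upwards [Lp.coeFn_add f g] with x hx
      rw [hx, Pi.add_apply, add_mul]
    have h1 := hF a φ hφ hc
    have h2 := hG a φ hφ hc
    simp only [PiLp.add_apply]
    rw [key _ _ _ (integrable_mul_iteratedFDeriv _ hφ hc _)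
      (integrable_mul_iteratedFDeriv _ hφ hc _), key _ _ _ (integrable_mul_of_test _
      hφ.continuous hc) (integrable_mul_of_test _ hφ.continuous hc), h1, h2, mul_add]
  smul_mem' := by
    intro c F hF a φ hφ hc
    have key : ∀ (f : L2 n) (ψ : Space n → ℝ),
        ∫ x, (c • f) x * ψ x = c * ∫ x, f x * ψ x := by
      intro f ψ
      rw [← integral_const_mul]
      refine integral_congr_ae ?_
      filter_upwards [Lp.coeFn_smul c f] with x hx
      rw [hx, Pi.smul_apply, smul_eq_mul, mul_assoc]
    have h1 := hF a φ hφ hc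
    simp only [PiLp.smul_apply]
    rw [key, key, h1]
    ring

/-- The underlying `L²` function of an element of `H^k(ℝⁿ)`. -/
noncomputable def fn {n k : ℕ} (F : Sobolev n k) : L2 n :=
  (F : PiLp 2 fun _ : DerivIndex n k => L2 n) (noDeriv n k)

/-- The weak partial derivative `∂_i f ∈ L²(ℝⁿ)` of `f ∈ H¹(ℝⁿ)`. -/
noncomputable def weakPartial {n : ℕ} (F : Sobolev n 1) (i : Fin n) : L2 n :=
  (F : PiLp 2 fun _ : DerivIndex n 1 => L2 n) ⟨1, fun _ => i⟩

/-- The time interval `[0, T)`, where `0 < T ≤ ∞`. -/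
def timeInterval (T : ℝ≥0∞) : Set ℝ := {t | 0 ≤ t ∧ ENNReal.ofReal t < T}

/-- `ψ ∈ C₀^∞([0, T) × ℝⁿ)`, i.e. `ψ` is smooth up to `t = 0` and vanishes near `t = T` and near
spatial infinity; as usual `ψ` is thought of as extended smoothly to negative times. -/
structure IsTestFunction {n : ℕ} (T : ℝ≥0∞) (ψ : ℝ → Space n → ℝ) : Prop where
  smooth : ContDiff ℝ ∞ (fun z : ℝ × Space n => ψ z.1 z.2)
  compact : HasCompactSupport (fun z : ℝ × Space n => ψ z.1 z.2)
  support : tsupport (fun z : ℝ × Space n => ψ z.1 z.2) ⊆ {z | ENNReal.ofReal z.1 < T}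

/-- The time derivative `ψ_s(s, x)`. -/
noncomputable def timeDeriv {n : ℕ} (ψ : ℝ → Space n → ℝ) (s : ℝ) (x : Space n) : ℝ :=
  deriv (fun τ => ψ τ x) s

/-- The spatial derivative `∂_i ψ(s, x)`. -/
noncomputable def spaceDeriv {n : ℕ} (ψ : ℝ → Space n → ℝ) (i : Fin n) (s : ℝ) (x : Space n) :
    ℝ :=
  fderiv ℝ (ψ s) x (e i)

/-- `u` is an energy solution on `[0, T)` of
`β u_ttt + u_tt - Δu - β Δu_t = |u|^p`, `(u, u_t, u_tt)(0) = ε (u₀, u₁, u₂)`,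
where `V₂`, `V₁`, `V₀` are `u` regarded as a curve in `H²`, in `H¹` and in `L²`.
So `u_t(s)` and `u_tt(s)` are the first and second derivative of `V₀` in `L²`, and `∇u(s)`,
`∇u_t(s)` are the weak gradients of `V₁(s)` and of the derivative of `V₁` in `H¹`. -/
structure IsEnergySolutionVia {n : ℕ} (β p ε : ℝ) (u₀ : Sobolev n 2) (u₁ : Sobolev n 1)
    (u₂ : L2 n) (T : ℝ≥0∞) (u : ℝ → Space n → ℝ)
    (V₂ : ℝ → Sobolev n 2) (V₁ : ℝ → Sobolev n 1) (V₀ : ℝ → L2 n) : Prop where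
  /-- `u ∈ C([0,T), H²)` -/
  eq₂ : ∀ t ∈ timeInterval T, u t =ᵐ[volume] fn (V₂ t)
  cont₂ : ContinuousOn V₂ (timeInterval T)
  /-- `u ∈ C¹([0,T), H¹)` -/
  eq₁ : ∀ t ∈ timeInterval T, u t =ᵐ[volume] fn (V₁ t)
  cont₁ : ContDiffOn ℝ 1 V₁ (timeInterval T)
  /-- `u ∈ C²([0,T), L²)` -/
  eq₀ : ∀ t ∈ timeInterval T, u t =ᵐ[volume] V₀ t
  cont₀ : ContDiffOn ℝ 2 V₀ (timeInterval T)
  /-- `u ∈ L^p_loc([0,T) × ℝⁿ)` -/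
  meas : AEStronglyMeasurable (fun z : ℝ × Space n => u z.1 z.2)
    (volume.restrict (timeInterval T ×ˢ univ))
  locInt : LocallyIntegrableOn (fun z : ℝ × Space n => |u z.1 z.2| ^ p) (timeInterval T ×ˢ univ)
  /-- the initial conditions, in `H²`, `H¹` and `L²` -/
  init₀ : V₂ 0 = ε • u₀
  init₁ : derivWithin V₁ (timeInterval T) 0 = ε • u₁
  init₂ : iteratedDerivWithin 2 V₀ (timeInterval T) 0 = ε • u₂
  /-- the integral identity -/
  identity : ∀ ψ : ℝ → Space n → ℝ, IsTestFunction T ψ → ∀ t ∈ timeInterval T,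
    β * (∫ x, iteratedDerivWithin 2 V₀ (timeInterval T) t x * ψ t x)
      + (∫ x, derivWithin V₀ (timeInterval T) t x * ψ t x)
      - β * ε * (∫ x, u₂ x * ψ 0 x)
      - ε * (∫ x, fn u₁ x * ψ 0 x)
      + β * (∫ s in (0 : ℝ)..t, ∫ x,
          ((∑ i, weakPartial (derivWithin V₁ (timeInterval T) s) i x * spaceDeriv ψ i s x)
            - iteratedDerivWithin 2 V₀ (timeInterval T) s x * timeDeriv ψ s x))
      + (∫ s in (0 : ℝ)..t, ∫ x,
          ((∑ i, weakPartial (V₁ s) i x * spaceDeriv ψ i s x)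
            - derivWithin V₀ (timeInterval T) s x * timeDeriv ψ s x))
    = ∫ s in (0 : ℝ)..t, ∫ x, |u s x| ^ p * ψ s x

/-- `u` is an energy solution on `[0, T)` of the semilinear Cauchy problem
`β u_ttt + u_tt - Δu - β Δu_t = |u|^p`, `(u, u_t, u_tt)(0) = ε (u₀, u₁, u₂)`. -/
def IsEnergySolution {n : ℕ} (β p ε : ℝ) (u₀ : Sobolev n 2) (u₁ : Sobolev n 1) (u₂ : L2 n)
    (T : ℝ≥0∞) (u : ℝ → Space n → ℝ) : Prop :=
  0 < T ∧ ∃ V₂ V₁ V₀, IsEnergySolutionVia β p ε u₀ u₁ u₂ T u V₂ V₁ V₀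

/-- `supp f ⊆ B_R` for a function defined up to null sets. -/
def SupportedInBall {n : ℕ} (R : ℝ) (f : Space n → ℝ) : Prop :=
  ∀ᵐ x, x ∉ Metric.closedBall (0 : Space n) R → f x = 0

/-- `supp u(t, ·) ⊆ B_{R+t}` for all `t ∈ (0, T)`. -/
def SupportedInCone {n : ℕ} (R : ℝ) (T : ℝ≥0∞) (u : ℝ → Space n → ℝ) : Prop :=
  ∀ t : ℝ, 0 < t → ENNReal.ofReal t < T → SupportedInBall (R + t) (u t)

/-- The lifespan of an energy solution `u` given on `[0, T)` (with support in the forward cone):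
the supremum of all `S ≥ T` such that `u` extends to such a solution on `[0, S)`.
The solution blows up in finite time if its lifespan is finite. -/
noncomputable def lifespan {n : ℕ} (β p ε R : ℝ) (u₀ : Sobolev n 2) (u₁ : Sobolev n 1)
    (u₂ : L2 n) (T : ℝ≥0∞) (u : ℝ → Space n → ℝ) : ℝ≥0∞ :=
  sSup {S | T ≤ S ∧ ∃ v : ℝ → Space n → ℝ, IsEnergySolution β p ε u₀ u₁ u₂ S v ∧
    SupportedInCone R S v ∧ ∀ t ∈ timeInterval T, v t =ᵐ[volume] u t}

/-- The solution `u` given on `[0, T)` blows up in finite time. -/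
def BlowsUpInFiniteTime {n : ℕ} (β p ε R : ℝ) (u₀ : Sobolev n 2) (u₁ : Sobolev n 1)
    (u₂ : L2 n) (T : ℝ≥0∞) (u : ℝ → Space n → ℝ) : Prop :=
  lifespan β p ε R u₀ u₁ u₂ T u < ⊤

/-- The Strauss exponent, the positive root of `(n-1) q² - (n+1) q - 2 = 0` (for `n ≥ 2`). -/
noncomputable def straussExponent (n : ℕ) : ℝ :=
  ((n + 1 : ℝ) + Real.sqrt ((n + 1 : ℝ) ^ 2 + 8 * (n - 1))) / (2 * (n - 1))

theorem eq_straussExponent_iff {n : ℕ} (hn : 2 ≤ n) {q : ℝ} (hq : 0 < q) :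
    q = straussExponent n ↔ ((n : ℝ) - 1) * q ^ 2 - (n + 1) * q - 2 = 0 := by
  have h2 : (2 : ℝ) ≤ n := by exact_mod_cast hn
  have hs : 0 ≤ (n + 1 : ℝ) ^ 2 + 8 * (n - 1) := by nlinarith
  have hr := Real.sq_sqrt hs
  have hr0 := Real.sqrt_nonneg ((n + 1 : ℝ) ^ 2 + 8 * (n - 1))
  set r := Real.sqrt ((n + 1 : ℝ) ^ 2 + 8 * (n - 1)) with hrdef
  have hrn : (n + 1 : ℝ) < r := by nlinarith
  rw [straussExponent, ← hrdef, eq_div_iff (by linarith)]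
  constructor
  · intro h
    have h3 : r = q * (2 * (n - 1)) - (n + 1) := by linarith
    rw [h3] at hr
    have : (4 * ((n : ℝ) - 1)) * (((n : ℝ) - 1) * q ^ 2 - (n + 1) * q - 2) = 0 := by nlinarith
    rcases mul_eq_zero.1 this with h | h
    · linarith
    · exact h
  · intro h
    have h3 : (q * (2 * (n - 1)) - (n + 1) - r) * (q * (2 * (n - 1)) - (n + 1) + r) = 0 := by
      nlinarith
    rcases mul_eq_zero.1 h3 with h | h
    · linarith
    · nlinarith [mul_pos hq (by linarith : (0 : ℝ) < 2 * (n - 1))]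

/-- `θ(p, n) = 2 + (n+1) p - (n-1) p²`. -/
noncomputable def theta (p : ℝ) (n : ℕ) : ℝ := 2 + (n + 1) * p - (n - 1) * p ^ 2

end MGT

/-! The proof follows two moments of the solution. If Δφ = lφ on the support of u, pairing the
equation with φ gives, formally, (β d/dt + 1)(G'' - lG) = ∫ |u|^p φ for G = ∫ u φ. Since u has only
two time derivatives, the once-integrated form is used (`exists_moment_derivatives`).

For l = 1 take the radial eigenfunction Φ, which grows like r^{-(n-1)/2} e^r. Nonnegativity of the
data and of the source gives G(t) ≥ c ε e^t (`exp_le_of_third_order`). Hölder on B_{R+t}, with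
`exists_integral_radialExp_rpow_le`, turns this into a lower bound for N = ∫ |u|^p of order ε^p
(1+t)^κ, κ = (n-1)(1 - p/2): the exponentials cancel.

For l = 0 take φ = 1. The mean U = ∫ u satisfies βU'' + U' = const + ∫ N with a nonnegative
constant, and Hölder gives N ≥ c (1+t)^{-n(p-1)} U^p.

A Kato type argument (`exists_kato_bound`) combines both. The first bound yields U(T) ≥ c ε^p
T^{κ+2}. If this is too large, the second bound makes U unbounded before time 2T. Hence existence up
to 2T forces ε^{p(p-1)} T^{θ/2} ≤ K, because (p-1)(κ+2) + 2 - n(p-1) = θ/2. As θ > 0 below the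
Strauss exponent, this bounds T by a power of ε. -/

namespace MGT

/-! ### The entire function behind the radial eigenfunction -/

/-- The coefficients of the entire function `s ↦ ∑ s^k / (k! ∏_{j<k} (4j + 2ν))`. -/
noncomputable def besselCoeff (ν : ℝ) (k : ℕ) : ℝ :=
  ((k.factorial : ℝ) * ∏ j ∈ Finset.range k, (4 * (j : ℝ) + 2 * ν))⁻¹

/-- The entire function `∑ s^k / (k! ∏_{j<k} (4j + 2ν))`; for `ν = n`, the function
`x ↦ bessel n (‖x‖²)` is the radial solution of `ΔΦ = Φ` on `ℝⁿ` with `Φ(0) = 1`. -/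
noncomputable def bessel (ν s : ℝ) : ℝ := ∑' k, besselCoeff ν k * s ^ k

theorem besselCoeff_pos {ν : ℝ} (hν : 0 < ν) (k : ℕ) : 0 < besselCoeff ν k := by
  unfold besselCoeff
  have : 0 < ∏ j ∈ Finset.range k, (4 * (j : ℝ) + 2 * ν) :=
    Finset.prod_pos fun j _ => by positivity
  positivity

theorem besselCoeff_zero (ν : ℝ) : besselCoeff ν 0 = 1 := by simp [besselCoeff]

theorem besselCoeff_le {ν : ℝ} (hν : 1 ≤ ν) (k : ℕ) :
    besselCoeff ν k ≤ ((k.factorial : ℝ))⁻¹ := by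
  unfold besselCoeff
  have hk : (0 : ℝ) < k.factorial := by exact_mod_cast k.factorial_pos
  have : 1 ≤ ∏ j ∈ Finset.range k, (4 * (j : ℝ) + 2 * ν) := by
    rw [← Finset.prod_const_one (s := Finset.range k)]
    refine Finset.prod_le_prod (fun _ _ => zero_le_one) fun j _ => ?_
    have : (0 : ℝ) ≤ j := by positivity
    linarith
  gcongr
  exact le_mul_of_one_le_right hk.le this

/-- Splitting off the factor j = 0 shifts the remaining product from ν to ν + 2. This is why
differentiating the series raises the parameter by two. -/
theorem besselCoeff_succ {ν : ℝ} (hν : 0 < ν) (k : ℕ) :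
    besselCoeff ν (k + 1) * (k + 1) = besselCoeff (ν + 2) k / (2 * ν) := by
  have h : ∏ j ∈ Finset.range (k + 1), (4 * (j : ℝ) + 2 * ν)
      = (∏ j ∈ Finset.range k, (4 * (j : ℝ) + 2 * (ν + 2))) * (2 * ν) := by
    rw [Finset.prod_range_succ']
    congr 1
    · refine Finset.prod_congr rfl fun j _ => ?_
      push_cast
      ring
    · simp
  have hk : (0 : ℝ) < k.factorial := by exact_mod_cast k.factorial_pos
  have hP : 0 < ∏ j ∈ Finset.range k, (4 * (j : ℝ) + 2 * (ν + 2)) :=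
    Finset.prod_pos fun j _ => by positivity
  unfold besselCoeff
  rw [h, Nat.factorial_succ]
  push_cast
  field_simp

/-- Contiguous relation for ₀F₁(; ν/2; s/4), whose power series this is. Summed up, it becomes the
radial equation f'' + (ν-1)/r f' = f for f(r) = `bessel ν (r ^ 2)`. -/
theorem besselCoeff_recurrence {ν : ℝ} (hν : 0 < ν) (k : ℕ) :
    besselCoeff ν (k + 1) =
      besselCoeff (ν + 2) (k + 1) + besselCoeff (ν + 4) k / (ν * (ν + 2)) := by
  have h1 := besselCoeff_succ hν k
  have h2 := besselCoeff_succ (ν := ν + 2) (by linarith) k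
  have h3 : besselCoeff (ν + 2) (k + 1) * (4 * k + 2 * ν + 4) * (k + 1) = besselCoeff (ν + 2) k := by
    unfold besselCoeff
    rw [Finset.prod_range_succ, Nat.factorial_succ]
    have hk : (0 : ℝ) < k.factorial := by exact_mod_cast k.factorial_pos
    have hP : 0 < ∏ j ∈ Finset.range k, (4 * (j : ℝ) + 2 * (ν + 2)) :=
      Finset.prod_pos fun j _ => by positivity
    push_cast
    have : 4 * (k : ℝ) + 2 * (ν + 2) ≠ 0 := by positivity
    field_simp
    ring
  have hk1 : (k : ℝ) + 1 ≠ 0 := by positivity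
  have e : ν + 2 + 2 = ν + 4 := by ring
  rw [e] at h2
  have h4 : besselCoeff (ν + 4) k = besselCoeff (ν + 2) (k + 1) * (k + 1) * (2 * (ν + 2)) := by
    rw [h2]
    field_simp
  have h5 : besselCoeff ν (k + 1) = besselCoeff (ν + 2) k / (2 * ν) / (k + 1) := by
    rw [← h1]
    field_simp
  rw [h5, h4, ← h3]
  field_simp
  ring

theorem summable_bessel {ν : ℝ} (hν : 1 ≤ ν) (s : ℝ) :
    Summable fun k => besselCoeff ν k * s ^ k := by
  refine Summable.of_norm_bounded (Real.summable_pow_div_factorial |s|) fun k => ?_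
  rw [norm_mul, norm_pow, Real.norm_eq_abs, Real.norm_eq_abs,
    abs_of_pos (besselCoeff_pos (by linarith) k), div_eq_inv_mul]
  exact mul_le_mul_of_nonneg_right (besselCoeff_le hν k) (by positivity)

theorem hasDerivAt_bessel {ν : ℝ} (hν : 1 ≤ ν) (s : ℝ) :
    HasDerivAt (bessel ν) (bessel (ν + 2) s / (2 * ν)) s := by
  have hsum : ∀ r : ℝ, Summable fun k : ℕ => besselCoeff ν k * (k * r ^ (k - 1)) := by
    intro r
    rw [← summable_nat_add_iff 1]
    refine ((summable_bessel (ν := ν + 2) (by linarith) r).div_const (2 * ν)).congr fun k => ?_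
    have := besselCoeff_succ (ν := ν) (by linarith) k
    simp only [Nat.add_sub_cancel]
    push_cast
    rw [← mul_assoc, this]
    ring
  have h := hasDerivAt_tsum_of_isPreconnected (u := fun k : ℕ =>
      besselCoeff ν k * (k * (|s| + 1) ^ (k - 1)))
    (g := fun (k : ℕ) (y : ℝ) => besselCoeff ν k * y ^ k)
    (g' := fun (k : ℕ) (y : ℝ) => besselCoeff ν k * (k * y ^ (k - 1)))
    (t := Metric.ball (0 : ℝ) (|s| + 1)) (y₀ := 0) (y := s) (hsum _) Metric.isOpen_ball
    (convex_ball _ _).isPreconnected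
    (fun k y _ => (hasDerivAt_pow k y).const_mul _) (fun k y hy => by
      rw [norm_mul, norm_mul, norm_pow, Real.norm_eq_abs, Real.norm_eq_abs, Real.norm_eq_abs,
        abs_of_pos (besselCoeff_pos (by linarith) k), Nat.abs_cast]
      have : |y| ≤ |s| + 1 := by
        rw [mem_ball_zero_iff, Real.norm_eq_abs] at hy
        exact hy.le
      have := besselCoeff_pos (ν := ν) (by linarith) k
      gcongr) (Metric.mem_ball_self (by positivity)) (summable_bessel hν _)
    (by rw [mem_ball_zero_iff, Real.norm_eq_abs]; linarith)
  have e : ∑' k : ℕ, besselCoeff ν k * (k * s ^ (k - 1)) = bessel (ν + 2) s / (2 * ν) := by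
    rw [(hsum s).tsum_eq_zero_add, bessel, ← tsum_div_const]
    simp only [Nat.cast_zero, zero_mul, mul_zero, zero_add, Nat.add_sub_cancel]
    refine tsum_congr fun k => ?_
    have := besselCoeff_succ (ν := ν) (by linarith) k
    push_cast
    rw [← mul_assoc, this]
    ring
  rw [e] at h
  exact h

theorem bessel_recurrence {ν : ℝ} (hν : 1 ≤ ν) (s : ℝ) :
    bessel ν s = bessel (ν + 2) s + s / (ν * (ν + 2)) * bessel (ν + 4) s := by
  have h1 := (summable_bessel (ν := ν + 2) (by linarith) s)
  have h2 := (summable_bessel (ν := ν + 4) (by linarith) s)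
  rw [bessel, bessel, bessel, (summable_bessel hν s).tsum_eq_zero_add, h1.tsum_eq_zero_add,
    besselCoeff_zero, besselCoeff_zero, ← tsum_mul_left, add_assoc,
    ← ((summable_nat_add_iff 1).2 h1).tsum_add (h2.mul_left _)]
  congr 1
  refine tsum_congr fun k => ?_
  rw [besselCoeff_recurrence (by linarith)]
  ring

theorem contDiff_bessel {ν : ℝ} (hν : 1 ≤ ν) : ContDiff ℝ ∞ (bessel ν) := by
  rw [contDiff_infty]
  intro m
  induction m generalizing ν with
  | zero =>
    exact contDiff_zero.2 (continuous_iff_continuousAt.2 fun s => (hasDerivAt_bessel hν s).continuousAt)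
  | succ m ih =>
    push_cast
    refine contDiff_succ_iff_deriv.2 ⟨fun s => (hasDerivAt_bessel hν s).differentiableAt,
      fun h => by simp at h, ?_⟩
    have : deriv (bessel ν) = fun s => bessel (ν + 2) s / (2 * ν) :=
      funext fun s => (hasDerivAt_bessel hν s).deriv
    rw [this]
    exact (ih (by linarith)).div_const _

theorem one_le_bessel {ν s : ℝ} (hν : 1 ≤ ν) (hs : 0 ≤ s) : 1 ≤ bessel ν s := by
  have h := (summable_bessel hν s).le_tsum 0 fun k _ =>
    mul_nonneg (besselCoeff_pos (by linarith) k).le (pow_nonneg hs k)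
  simpa [besselCoeff_zero, bessel] using h

/-- The radial profile `r ↦ bessel ν (r²)` grows at most like `r^{-(ν-1)/2} e^r`. -/
theorem exists_bessel_sq_le {ν : ℝ} (hν : 1 ≤ ν) :
    ∃ C : ℝ, 0 < C ∧ ∀ r : ℝ, 0 ≤ r →
      bessel ν (r ^ 2) ≤ C * (1 + r) ^ (-((ν - 1) / 2)) * Real.exp r := by
  set m : ℝ := (ν - 1) / 2 with hm
  have hm0 : 0 ≤ m := by rw [hm]; linarith
  set f : ℝ → ℝ := fun r => bessel ν (r ^ 2) with hf
  set f' : ℝ → ℝ := fun r => r / ν * bessel (ν + 2) (r ^ 2) with hf'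
  have hfd : ∀ r, HasDerivAt f (f' r) r := by
    intro r
    have h := (hasDerivAt_bessel hν (r ^ 2)).comp r (hasDerivAt_pow 2 r)
    refine h.congr_deriv ?_
    simp only [hf']
    push_cast
    field_simp
  have hfd' : ∀ r, 0 < r → HasDerivAt f' (f r - 2 * m * (f' r / r)) r := by
    intro r hr
    have h1 := (hasDerivAt_bessel (ν := ν + 2) (by linarith) (r ^ 2)).comp r (hasDerivAt_pow 2 r)
    have h2 := ((hasDerivAt_id r).div_const ν).mul h1
    refine h2.congr_deriv ?_
    have e : ν + 2 + 2 = ν + 4 := by ring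
    have hν2 : ν + 2 ≠ 0 := by positivity
    simp only [hf', hf, e, bessel_recurrence hν (r ^ 2), hm, Function.comp, id]
    push_cast
    field_simp
    ring
  have hf1 : ∀ r, 1 ≤ f r := fun r => one_le_bessel hν (by positivity)
  have hf'0 : ∀ r, 0 ≤ r → 0 ≤ f' r := fun r hr => by
    have := one_le_bessel (ν := ν + 2) (s := r ^ 2) (by linarith) (by positivity)
    have : 0 ≤ bessel (ν + 2) (r ^ 2) := by linarith
    simp only [hf']
    positivity
  -- With g = r^m f the radial equation becomes g'' = (1 + m(m-1)/r²) g. Here h = g + g', so h' = h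
  -- + m(m-1)/r² · g.
  set h : ℝ → ℝ := fun r => r ^ m * (f r + f' r + m * (f r / r)) with hh
  have hhd : ∀ r, 0 < r → HasDerivAt h (h r + m * (m - 1) / r ^ 2 * (r ^ m * f r)) r := by
    intro r hr
    have h1 := Real.hasDerivAt_rpow_const (x := r) (p := m) (Or.inl hr.ne')
    have h2 := ((hfd r).add (hfd' r hr)).add (((hfd r).div (hasDerivAt_id r) hr.ne').const_mul m)
    refine (h1.mul h2).congr_deriv ?_
    have e : r ^ (m - 1) = r ^ m / r := by rw [Real.rpow_sub hr, Real.rpow_one]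
    simp only [hh, e, id, Pi.add_apply, Pi.div_apply]
    field_simp
    ring
  -- Removing e^r leaves only the perturbation m(m-1)g/r². The factor exp(m²/r) contributes -m²h/r²,
  -- which dominates it because 0 ≤ g ≤ h; being at least 1, the factor can be dropped at the end.
  set k : ℝ → ℝ := fun r => h r * Real.exp (m ^ 2 / r - r) with hk
  have hkd : ∀ r, 0 < r → HasDerivAt k ((h r + m * (m - 1) / r ^ 2 * (r ^ m * f r))
      * Real.exp (m ^ 2 / r - r) + h r * (Real.exp (m ^ 2 / r - r) * (-(m ^ 2) / r ^ 2 - 1))) r := by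
    intro r hr
    refine (hhd r hr).mul ?_
    refine HasDerivAt.exp ?_
    have := ((hasDerivAt_inv hr.ne').const_mul (m ^ 2)).sub (hasDerivAt_id r)
    refine (this.congr_deriv ?_).congr_of_eventuallyEq ?_
    · field_simp
    · exact Filter.Eventually.of_forall fun x => by simp [div_eq_mul_inv]
  have hanti : AntitoneOn k (Ici 1) := by
    refine antitoneOn_of_hasDerivWithinAt_nonpos (convex_Ici 1)
      (fun r hr => (hkd r (by have : (1 : ℝ) ≤ r := hr; linarith)).continuousAt.continuousWithinAt)
      (fun r hr => ((hkd r ?_).hasDerivWithinAt)) ?_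
    · rw [interior_Ici] at hr
      have : (1 : ℝ) < r := hr
      linarith
    · intro r hr
      rw [interior_Ici] at hr
      have hr1 : (1 : ℝ) < r := hr
      have hr0 : 0 < r := by linarith
      have hE := Real.exp_pos (m ^ 2 / r - r)
      have hle : r ^ m * f r ≤ h r := by
        have : 0 ≤ f r := by linarith [hf1 r]
        have := hf'0 r hr0.le
        simp only [hh]
        have : 0 ≤ m * (f r / r) := by positivity
        gcongr
        linarith
      have h0 : 0 ≤ r ^ m * f r := mul_nonneg (by positivity) (by linarith [hf1 r])
      have e : (h r + m * (m - 1) / r ^ 2 * (r ^ m * f r)) * Real.exp (m ^ 2 / r - r)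
          + h r * (Real.exp (m ^ 2 / r - r) * (-(m ^ 2) / r ^ 2 - 1))
          = -(Real.exp (m ^ 2 / r - r) / r ^ 2 * (m ^ 2 * (h r - r ^ m * f r)
            + m * (r ^ m * f r))) := by
        field_simp
        ring
      rw [e, neg_nonpos]
      have : 0 ≤ h r - r ^ m * f r := by linarith
      positivity
  have hk1 : 0 < k 1 := by
    simp only [hk, hh]
    have := hf1 1
    have := hf'0 1 zero_le_one
    have : 0 ≤ m * (f 1 / 1) := by positivity
    have : 0 < f 1 + f' 1 + m * (f 1 / 1) := by linarith
    positivity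
  refine ⟨2 ^ m * (k 1 + f 1), by have := hf1 1; positivity, fun r hr => ?_⟩
  have hpow : (1 + r) ^ (-m) = ((1 + r) ^ m)⁻¹ := Real.rpow_neg (by linarith) m
  have hp0 : 0 < (1 + r) ^ m := Real.rpow_pos_of_pos (by linarith) m
  rw [hpow]
  -- Monotonicity of k is available only on [1, ∞); on [0, 1] the bound f r ≤ f 1 suffices.
  rcases le_total r 1 with hr1 | hr1
  · have hfm : MonotoneOn f (Ici 0) :=
      monotoneOn_of_hasDerivWithinAt_nonneg (convex_Ici 0)
        (fun r _ => (hfd r).continuousAt.continuousWithinAt)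
        (fun r _ => (hfd r).hasDerivWithinAt)
        (fun r hr => hf'0 r (interior_subset hr))
    have h1 : f r ≤ f 1 := hfm hr (by simp) hr1
    have h2 : (1 + r) ^ m ≤ 2 ^ m := Real.rpow_le_rpow (by linarith) (by linarith) hm0
    have h3 : 1 ≤ Real.exp r := Real.one_le_exp hr
    have h4 := hf1 1
    calc f r ≤ f 1 := h1
      _ ≤ k 1 + f 1 := by linarith
      _ = (k 1 + f 1) * 1 * 1 := by ring
      _ ≤ (k 1 + f 1) * (2 ^ m * ((1 + r) ^ m)⁻¹) * Real.exp r := by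
        gcongr
        rw [← div_eq_mul_inv, one_le_div hp0]
        exact h2
      _ = _ := by ring
  · have hr0 : 0 < r := by linarith
    have h1 : k r ≤ k 1 := hanti (by simp) hr1 hr1
    have h2 : r ^ m * f r ≤ k r * Real.exp r := by
      have e : k r * Real.exp r = h r * Real.exp (m ^ 2 / r) := by
        simp only [hk]
        rw [mul_assoc, ← Real.exp_add]
        congr 2
        ring
      have h3 : 1 ≤ Real.exp (m ^ 2 / r) := Real.one_le_exp (by positivity)
      have hle : r ^ m * f r ≤ h r := by
        have : 0 ≤ f r := by linarith [hf1 r]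
        have := hf'0 r hr0.le
        simp only [hh]
        have : 0 ≤ m * (f r / r) := by positivity
        gcongr
        linarith
      have h0 : 0 ≤ r ^ m * f r := mul_nonneg (by positivity) (by linarith [hf1 r])
      rw [e]
      nlinarith
    have h4 : (1 + r) ^ m ≤ 2 ^ m * r ^ m := by
      rw [← Real.mul_rpow (by norm_num) hr0.le]
      exact Real.rpow_le_rpow (by linarith) (by linarith) hm0
    have h5 : (1 + r) ^ m * f r ≤ 2 ^ m * (k 1 + f 1) * Real.exp r := by
      have := hf1 r
      have := hf1 1
      calc (1 + r) ^ m * f r ≤ 2 ^ m * r ^ m * f r := by gcongr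
        _ = 2 ^ m * (r ^ m * f r) := by ring
        _ ≤ 2 ^ m * ((k 1 + f 1) * Real.exp r) := by
          refine mul_le_mul_of_nonneg_left ?_ (by positivity)
          refine h2.trans (mul_le_mul_of_nonneg_right ?_ (Real.exp_pos r).le)
          linarith
        _ = _ := by ring
    calc f r = ((1 + r) ^ m)⁻¹ * ((1 + r) ^ m * f r) := by field_simp
      _ ≤ ((1 + r) ^ m)⁻¹ * (2 ^ m * (k 1 + f 1) * Real.exp r) := by gcongr
      _ = _ := by ring

/-! ### The radial eigenfunction of the Laplacian -/

/-- The Laplacian of a function on `ℝⁿ`. -/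
noncomputable def lap {n : ℕ} (φ : Space n → ℝ) (x : Space n) : ℝ :=
  ∑ i, fderiv ℝ (fun y => fderiv ℝ φ y (e i)) x (e i)

/-- The radial solution of `ΔΦ = Φ` on `ℝⁿ` with `Φ(0) = 1`. -/
noncomputable def radialExp {n : ℕ} (x : Space n) : ℝ := bessel n (‖x‖ ^ 2)

theorem contDiff_radialExp {n : ℕ} (hn : 1 ≤ n) : ContDiff ℝ ∞ (radialExp (n := n)) :=
  (contDiff_bessel (by exact_mod_cast hn)).comp (contDiff_norm_sq ℝ)

theorem one_le_radialExp {n : ℕ} (hn : 1 ≤ n) (x : Space n) : 1 ≤ radialExp x :=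
  one_le_bessel (by exact_mod_cast hn) (by positivity)

theorem hasFDerivAt_bessel_norm_sq {n : ℕ} {ν : ℝ} (hν : 1 ≤ ν) (x : Space n) :
    HasFDerivAt (fun y : Space n => bessel ν (‖y‖ ^ 2))
      ((bessel (ν + 2) (‖x‖ ^ 2) / (2 * ν)) • (2 • innerSL ℝ x)) x :=
  (hasDerivAt_bessel hν _).comp_hasFDerivAt x (hasStrictFDerivAt_norm_sq x).hasFDerivAt

theorem inner_e {n : ℕ} (x : Space n) (i : Fin n) : inner ℝ x (e i) = x i := by
  simp [e, EuclideanSpace.inner_single_right]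

/-- Two differentiations produce the parameters n + 2 and n + 4; summing over the coordinates gives
exactly the right-hand side of `bessel_recurrence`. -/
theorem lap_radialExp {n : ℕ} (hn : 1 ≤ n) (x : Space n) : lap radialExp x = radialExp x := by
  have hν : (1 : ℝ) ≤ n := by exact_mod_cast hn
  have h1 : ∀ (y : Space n) (i : Fin n), fderiv ℝ radialExp y (e i)
      = bessel ((n : ℝ) + 2) (‖y‖ ^ 2) * (y i / n) := by
    intro y i
    have := (hasFDerivAt_bessel_norm_sq hν y).fderiv
    unfold radialExp
    rw [this]
    simp only [smul_apply, innerSL_apply_apply, inner_e, smul_eq_mul, nsmul_eq_mul]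
    push_cast
    field_simp
  have h2 : ∀ i : Fin n, fderiv ℝ (fun y : Space n => fderiv ℝ radialExp y (e i)) x (e i)
      = bessel ((n : ℝ) + 4) (‖x‖ ^ 2) / (n * (n + 2)) * (x i) ^ 2
        + bessel ((n : ℝ) + 2) (‖x‖ ^ 2) / n := by
    intro i
    simp only [h1]
    have h3 := hasFDerivAt_bessel_norm_sq (ν := (n : ℝ) + 2) (by linarith) x
    have h4 : HasFDerivAt (fun y : Space n => y i / (n : ℝ))
        ((n : ℝ)⁻¹ • (EuclideanSpace.proj i : Space n →L[ℝ] ℝ)) x := by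
      have := ((EuclideanSpace.proj i : Space n →L[ℝ] ℝ).hasFDerivAt (x := x)).const_mul ((n : ℝ)⁻¹)
      refine this.congr_of_eventuallyEq (Filter.Eventually.of_forall fun y => ?_)
      simp [div_eq_inv_mul]
    have h5 := (h3.mul h4).fderiv
    rw [Pi.mul_def] at h5
    rw [h5]
    have hn2 : (n : ℝ) + 2 ≠ 0 := by positivity
    have e1 : (n : ℝ) + 2 + 2 = n + 4 := by ring
    have hproj : (EuclideanSpace.proj i : Space n →L[ℝ] ℝ) (e i) = 1 := by simp [e]
    simp only [add_apply, smul_apply, innerSL_apply_apply,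
      inner_e, smul_eq_mul, nsmul_eq_mul, e1, hproj]
    push_cast
    field_simp
    ring
  unfold lap
  simp only [h2]
  rw [Finset.sum_add_distrib, ← Finset.mul_sum, ← EuclideanSpace.real_norm_sq_eq]
  simp only [Finset.sum_const, Finset.card_univ, Fintype.card_fin, nsmul_eq_mul]
  rw [radialExp, bessel_recurrence hν]
  field_simp
  ring

/-! ### Integrals of powers of the eigenfunction over balls -/

/-- The exponential dominates, so the integral is controlled by the endpoint value. The weight 1 + r
is first replaced by K + r, with K so large that |b|/(K + r) ≤ q/2; then the derivative of (K + r)^b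
e^{qr} is at least q/2 times the function itself. -/
theorem exists_integral_rpow_mul_exp_le (b : ℝ) {q : ℝ} (hq : 0 < q) :
    ∃ C : ℝ, 0 < C ∧ ∀ ρ : ℝ, 0 ≤ ρ →
      ∫ r in (0 : ℝ)..ρ, (1 + r) ^ b * Real.exp (q * r) ≤ C * (1 + ρ) ^ b * Real.exp (q * ρ) := by
  set K : ℝ := 1 + 2 * |b| / q with hK
  have hK1 : 1 ≤ K := by
    have : 0 ≤ 2 * |b| / q := by positivity
    linarith
  -- `(1 + r)^b` and `(K + r)^b` are comparable
  have hcmp : ∀ r : ℝ, 0 ≤ r → (1 + r) ^ b ≤ K ^ |b| * (K + r) ^ b ∧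
      (K + r) ^ b ≤ K ^ |b| * (1 + r) ^ b := by
    intro r hr
    have h1 : 0 < (1 + r) := by linarith
    have h2 : 0 < (K + r) := by linarith
    have h3 : K + r ≤ K * (1 + r) := by nlinarith
    have hKb : 1 ≤ K ^ |b| := Real.one_le_rpow hK1 (abs_nonneg b)
    have p1 := Real.rpow_pos_of_pos h1 b
    have p2 := Real.rpow_pos_of_pos h2 b
    rcases le_total 0 b with hb | hb
    · rw [abs_of_nonneg hb] at hKb ⊢
      constructor
      · have : (1 + r) ^ b ≤ (K + r) ^ b := Real.rpow_le_rpow h1.le (by linarith) hb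
        nlinarith
      · rw [← Real.mul_rpow (by linarith) h1.le]
        exact Real.rpow_le_rpow h2.le h3 hb
    · constructor
      · have h4 : (K * (1 + r)) ^ b ≤ (K + r) ^ b := Real.rpow_le_rpow_of_nonpos h2 h3 hb
        rw [Real.mul_rpow (by linarith) h1.le] at h4
        rw [abs_of_nonpos hb, Real.rpow_neg (by linarith)]
        have : 0 < K ^ b := Real.rpow_pos_of_pos (by linarith) b
        rw [← div_eq_inv_mul, le_div_iff₀ this]
        linarith
      · have : (K + r) ^ b ≤ (1 + r) ^ b := Real.rpow_le_rpow_of_nonpos h1 (by linarith) hb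
        nlinarith
  refine ⟨K ^ |b| * (2 / q) * K ^ |b|, by positivity, fun ρ hρ => ?_⟩
  have hd : ∀ r : ℝ, 0 ≤ r → HasDerivAt (fun r => (K + r) ^ b * Real.exp (q * r))
      ((q + b / (K + r)) * ((K + r) ^ b * Real.exp (q * r))) r := by
    intro r hr
    have h2 : 0 < K + r := by linarith
    have h3 := ((hasDerivAt_id r).const_add K).rpow_const (p := b) (Or.inl h2.ne')
    have h4 := ((hasDerivAt_id r).const_mul q).exp
    refine (h3.mul h4).congr_deriv ?_
    simp only [id, Real.rpow_sub h2, Real.rpow_one]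
    field_simp
    ring
  have hcont1 : ∀ (K : ℝ), 1 ≤ K → ContinuousOn (fun r : ℝ => (K + r) ^ b * Real.exp (q * r))
      (Icc 0 ρ) := by
    intro K hK
    refine ContinuousOn.mul (ContinuousOn.rpow_const (by fun_prop) ?_) (by fun_prop)
    intro r hr
    have := hr.1
    left
    linarith
  have hcont2 : ContinuousOn (fun r : ℝ => (q + b / (K + r)) * ((K + r) ^ b * Real.exp (q * r)))
      (Icc 0 ρ) := by
    refine ContinuousOn.mul ?_ (hcont1 K hK1)
    refine continuousOn_const.add (continuousOn_const.div (by fun_prop) ?_)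
    intro r hr
    have := hr.1
    linarith
  have hi1 : IntervalIntegrable (fun r : ℝ => (1 + r) ^ b * Real.exp (q * r)) volume 0 ρ :=
    ((hcont1 1 le_rfl).mono (by rw [uIcc_of_le hρ])).intervalIntegrable
  have hi2 : IntervalIntegrable (fun r : ℝ => (q + b / (K + r)) *
      ((K + r) ^ b * Real.exp (q * r))) volume 0 ρ :=
    (hcont2.mono (by rw [uIcc_of_le hρ])).intervalIntegrable
  have hFTC := intervalIntegral.integral_eq_sub_of_hasDerivAt
    (fun r hr => hd r (by rw [uIcc_of_le hρ] at hr; exact hr.1)) hi2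
  have hmono : ∫ r in (0 : ℝ)..ρ, (1 + r) ^ b * Real.exp (q * r) ≤
      ∫ r in (0 : ℝ)..ρ, (K ^ |b| * (2 / q)) *
        ((q + b / (K + r)) * ((K + r) ^ b * Real.exp (q * r))) := by
    refine intervalIntegral.integral_mono_on hρ hi1 (hi2.const_mul _) fun r hr => ?_
    have hr0 := hr.1
    have h2 : 0 < K + r := by linarith
    have h5 : q / 2 ≤ q + b / (K + r) := by
      have h6 : |b| / (K + r) ≤ q / 2 := by
        rw [div_le_iff₀ h2]
        have : q / 2 * (2 * |b| / q) = |b| := by field_simp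
        nlinarith
      have h7 : -(|b| / (K + r)) ≤ b / (K + r) := by
        rw [← neg_div]
        gcongr
        exact neg_abs_le b
      linarith
    have hE := Real.exp_pos (q * r)
    have hp := Real.rpow_pos_of_pos h2 b
    calc (1 + r) ^ b * Real.exp (q * r) ≤ (K ^ |b| * (K + r) ^ b) * Real.exp (q * r) := by
          gcongr
          exact (hcmp r hr0).1
      _ = (K ^ |b| * (2 / q)) * (q / 2 * ((K + r) ^ b * Real.exp (q * r))) := by field_simp
      _ ≤ _ := by gcongr
  rw [intervalIntegral.integral_const_mul, hFTC] at hmono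
  have hK0 : 0 < (K + 0) ^ b * Real.exp (q * 0) := by
    have : 0 < K + 0 := by linarith
    positivity
  have h2 : 0 < K + ρ := by linarith
  calc _ ≤ _ := hmono
    _ ≤ K ^ |b| * (2 / q) * ((K + ρ) ^ b * Real.exp (q * ρ)) := by
        gcongr
        linarith
    _ ≤ K ^ |b| * (2 / q) * ((K ^ |b| * (1 + ρ) ^ b) * Real.exp (q * ρ)) := by
        gcongr
        exact (hcmp ρ hρ).2
    _ = _ := by ring

/-- In polar coordinates the density r^{n-1} meets Φ^q ≤ C (1+r)^{-(n-1)q/2} e^{qr}, which leaves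
the integrand of the preceding estimate with b = (n-1)(1 - q/2). -/
theorem exists_integral_radialExp_rpow_le {n : ℕ} (hn : 1 ≤ n) {q : ℝ} (hq : 0 < q) :
    ∃ C : ℝ, 0 < C ∧ ∀ ρ : ℝ, 0 ≤ ρ →
      ∫ x in Metric.closedBall (0 : Space n) ρ, radialExp x ^ q
        ≤ C * (1 + ρ) ^ (((n : ℝ) - 1) * (1 - q / 2)) * Real.exp (q * ρ) := by
  have hν : (1 : ℝ) ≤ n := by exact_mod_cast hn
  have : Nonempty (Fin n) := ⟨⟨0, hn⟩⟩
  obtain ⟨C₁, hC₁, h1⟩ := exists_bessel_sq_le hν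
  obtain ⟨C₂, hC₂, h2⟩ := exists_integral_rpow_mul_exp_le (((n : ℝ) - 1) * (1 - q / 2)) hq
  set κ : ℝ := (volume : Measure (Space n)).real (Metric.ball 0 1) with hκ
  have hκ0 : 0 ≤ κ := measureReal_nonneg
  refine ⟨n * (κ + 1) * (C₁ ^ q * C₂), by positivity, fun ρ hρ => ?_⟩
  set g : ℝ → ℝ := (Iic ρ).indicator fun r => bessel n (r ^ 2) ^ q with hg
  have e1 : ∫ x in Metric.closedBall (0 : Space n) ρ, radialExp x ^ q = ∫ x : Space n, g ‖x‖ := by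
    rw [← integral_indicator measurableSet_closedBall]
    congr 1
    ext x
    by_cases hx : ‖x‖ ≤ ρ <;> simp [g, indicator, hx, radialExp]
  have e2 : ∫ y in Ioi (0 : ℝ), y ^ (n - 1) • g y
      = ∫ r in (0 : ℝ)..ρ, r ^ (n - 1) * bessel n (r ^ 2) ^ q := by
    rw [intervalIntegral.integral_of_le hρ, ← integral_indicator measurableSet_Ioi,
      ← integral_indicator measurableSet_Ioc]
    congr 1
    ext r
    by_cases h0 : 0 < r <;> by_cases hr : r ≤ ρ <;> simp [g, indicator, h0, hr]
  have hb0 : ∀ r : ℝ, 0 < bessel n (r ^ 2) := fun r =>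
    zero_lt_one.trans_le (one_le_bessel hν (by positivity))
  have hcont : Continuous fun r : ℝ => bessel n (r ^ 2) :=
    (contDiff_bessel hν).continuous.comp (by fun_prop)
  have e3 : ∫ r in (0 : ℝ)..ρ, r ^ (n - 1) * bessel n (r ^ 2) ^ q
      ≤ ∫ r in (0 : ℝ)..ρ, C₁ ^ q * ((1 + r) ^ (((n : ℝ) - 1) * (1 - q / 2)) * Real.exp (q * r)) := by
    refine intervalIntegral.integral_mono_on hρ ?_ ?_ fun r hr => ?_
    · refine Continuous.intervalIntegrable ?_ _ _
      exact (by fun_prop : Continuous fun r : ℝ => r ^ (n - 1)).mul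
        (hcont.rpow_const fun r => Or.inl (hb0 r).ne')
    · refine ContinuousOn.intervalIntegrable ?_
      rw [uIcc_of_le hρ]
      refine continuousOn_const.mul (ContinuousOn.mul (ContinuousOn.rpow_const (by fun_prop) ?_)
        (by fun_prop))
      intro r hr
      have := hr.1
      left
      linarith
    · have hr0 := hr.1
      have hr1 : 0 < 1 + r := by linarith
      have h3 : bessel n (r ^ 2) ^ q ≤ (C₁ * (1 + r) ^ (-(((n : ℝ) - 1) / 2)) * Real.exp r) ^ q :=
        Real.rpow_le_rpow (hb0 r).le (h1 r hr0) hq.le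
      have h4 : (r : ℝ) ^ (n - 1) ≤ (1 + r) ^ ((n : ℝ) - 1) := by
        have : (1 + r) ^ ((n : ℝ) - 1) = (1 + r) ^ (n - 1) := by
          rw [← Real.rpow_natCast]
          congr 1
          push_cast [hn]
          ring
        rw [this]
        exact pow_le_pow_left₀ hr0 (by linarith) _
      have h5 : (C₁ * (1 + r) ^ (-(((n : ℝ) - 1) / 2)) * Real.exp r) ^ q
          = C₁ ^ q * (1 + r) ^ (-(((n : ℝ) - 1) / 2) * q) * Real.exp (q * r) := by
        rw [Real.mul_rpow (by positivity) (by positivity), Real.mul_rpow hC₁.le (by positivity),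
          ← Real.rpow_mul hr1.le, ← Real.exp_mul, mul_comm r q]
      calc r ^ (n - 1) * bessel n (r ^ 2) ^ q
          ≤ (1 + r) ^ ((n : ℝ) - 1) *
            (C₁ ^ q * (1 + r) ^ (-(((n : ℝ) - 1) / 2) * q) * Real.exp (q * r)) := by
            rw [← h5]
            have := (hb0 r).le
            gcongr
        _ = C₁ ^ q * (((1 + r) ^ ((n : ℝ) - 1) * (1 + r) ^ (-(((n : ℝ) - 1) / 2) * q))
            * Real.exp (q * r)) := by ring
        _ = _ := by
            rw [← Real.rpow_add hr1]
            congr 4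
            ring
  rw [e1, integral_fun_norm_addHaar, finrank_euclideanSpace_fin, e2]
  simp only [nsmul_eq_mul, smul_eq_mul, ← hκ]
  rw [intervalIntegral.integral_const_mul] at e3
  have h6 := h2 ρ hρ
  have hP : 0 ≤ C₁ ^ q * (C₂ * (1 + ρ) ^ (((n : ℝ) - 1) * (1 - q / 2)) * Real.exp (q * ρ)) := by
    have : 0 < 1 + ρ := by linarith
    positivity
  calc _ ≤ (n : ℝ) * (κ * (C₁ ^ q * (C₂ * (1 + ρ) ^ (((n : ℝ) - 1) * (1 - q / 2))
          * Real.exp (q * ρ)))) := by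
        gcongr
        refine e3.trans ?_
        gcongr
    _ ≤ (n : ℝ) * ((κ + 1) * (C₁ ^ q * (C₂ * (1 + ρ) ^ (((n : ℝ) - 1) * (1 - q / 2))
          * Real.exp (q * ρ)))) := by
        gcongr
        linarith
    _ = _ := by ring

/-! ### Pairings, time intervals and stationary test functions -/

/-- The functional `f ↦ ∫ f φ` on `L²(ℝⁿ)`. -/
noncomputable def pair {n : ℕ} {φ : Space n → ℝ} (hφ : MemLp φ 2) : L2 n →L[ℝ] ℝ :=
  innerSL ℝ (hφ.toLp φ)

theorem pair_apply {n : ℕ} {φ : Space n → ℝ} (hφ : MemLp φ 2) (f : L2 n) :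
    pair hφ f = ∫ x, f x * φ x := by
  rw [pair, innerSL_apply_apply, L2.inner_def]
  refine integral_congr_ae ?_
  filter_upwards [hφ.coeFn_toLp] with x hx
  rw [hx]
  simp

/-- `fn` as a continuous linear map. -/
noncomputable def fnL (n k : ℕ) : Sobolev n k →L[ℝ] L2 n :=
  (PiLp.proj 2 (fun _ : DerivIndex n k => L2 n) (noDeriv n k)).comp (Sobolev n k).subtypeL

theorem timeInterval_subset {S : ℝ≥0∞} {τ : ℝ} (hτ : τ ∈ timeInterval S) :
    Icc 0 τ ⊆ timeInterval S := fun _ ht =>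
  ⟨ht.1, (ENNReal.ofReal_le_ofReal ht.2).trans_lt hτ.2⟩

theorem exists_gt_mem_timeInterval {S : ℝ≥0∞} {τ : ℝ} (hτ : τ ∈ timeInterval S) :
    ∃ τ' ∈ timeInterval S, τ < τ' := by
  obtain ⟨a, ha, haS⟩ := ENNReal.lt_iff_exists_nnreal_btwn.1 hτ.2
  refine ⟨a, ⟨a.2, by rwa [ENNReal.ofReal_coe_nnreal]⟩, ?_⟩
  have := (ENNReal.ofReal_lt_coe_iff hτ.1).1 ha
  exact this

theorem uniqueDiffOn_timeInterval {S : ℝ≥0∞} (hS : 0 < S) : UniqueDiffOn ℝ (timeInterval S) := by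
  have h0 : (0 : ℝ) ∈ timeInterval S := ⟨le_rfl, by simpa using hS⟩
  obtain ⟨τ, hτ, h0τ⟩ := exists_gt_mem_timeInterval h0
  refine uniqueDiffOn_convex ?_ ?_
  · refine OrdConnected.convex ⟨fun x hx y hy z hz => ⟨hx.1.trans hz.1, ?_⟩⟩
    exact (ENNReal.ofReal_le_ofReal hz.2).trans_lt hy.2
  · refine ⟨τ / 2, interior_mono (timeInterval_subset hτ) ?_⟩
    rw [interior_Icc]
    constructor <;> linarith

section Test

variable {n : ℕ} {φ : Space n → ℝ}

theorem contDiff_partial (hφ : ContDiff ℝ ∞ φ) (i : Fin n) :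
    ContDiff ℝ ∞ fun y => fderiv ℝ φ y (e i) :=
  (hφ.fderiv_right (m := ∞) (by simp)).clm_apply contDiff_const

theorem hasCompactSupport_partial (hc : HasCompactSupport φ) (i : Fin n) :
    HasCompactSupport fun y => fderiv ℝ φ y (e i) := hc.fderiv_apply ℝ (e i)

theorem memLp_test (hφ : ContDiff ℝ ∞ φ) (hc : HasCompactSupport φ) :
    MemLp φ 2 (volume : Measure (Space n)) := hφ.continuous.memLp_of_hasCompactSupport hc

theorem memLp_lap (hφ : ContDiff ℝ ∞ φ) (hc : HasCompactSupport φ) :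
    MemLp (lap φ) 2 (volume : Measure (Space n)) := by
  unfold lap
  exact memLp_finsetSum _ fun i _ => memLp_test (contDiff_partial (contDiff_partial hφ i) i)
    (hasCompactSupport_partial (hasCompactSupport_partial hc i) i)

/-- The weak derivative is tested against ∂_i φ, so both derivatives of the Laplacian fall on φ.
First-order regularity of F is enough, which matters because u_t lies only in H¹. -/
theorem integral_weakPartial_mul (F : Sobolev n 1) (hφ : ContDiff ℝ ∞ φ)
    (hc : HasCompactSupport φ) (i : Fin n) :
    ∫ x, weakPartial F i x * fderiv ℝ φ x (e i)
      = -∫ x, fn F x * fderiv ℝ (fun y => fderiv ℝ φ y (e i)) x (e i) := by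
  have h := F.2 ⟨1, fun _ => i⟩ (fun y => fderiv ℝ φ y (e i)) (contDiff_partial hφ i)
    (hasCompactSupport_partial hc i)
  have h1 : ∀ x, iteratedFDeriv ℝ ((1 : Fin (1 + 1)) : ℕ) (fun y => fderiv ℝ φ y (e i)) x
      (fun _ => e i) = fderiv ℝ (fun y => fderiv ℝ φ y (e i)) x (e i) :=
    fun x => iteratedFDeriv_one_apply (fun _ => e i)
  simp only [h1] at h
  have h2 : ((-1 : ℝ)) ^ ((1 : Fin (1 + 1)) : ℕ) = -1 := pow_one _
  rw [h2] at h
  unfold fn weakPartial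
  linarith

theorem integral_gradient_mul (F : Sobolev n 1) (hφ : ContDiff ℝ ∞ φ)
    (hc : HasCompactSupport φ) :
    ∫ x, ∑ i, weakPartial F i x * fderiv ℝ φ x (e i) = -∫ x, fn F x * lap φ x := by
  unfold lap
  rw [integral_finsetSum]
  · simp only [integral_weakPartial_mul F hφ hc, Finset.mul_sum]
    rw [integral_finsetSum, Finset.sum_neg_distrib]
    exact fun i _ => integrable_mul_of_test _ (contDiff_partial (contDiff_partial hφ i) i).continuous
      (hasCompactSupport_partial (hasCompactSupport_partial hc i) i)
  · exact fun i _ => integrable_mul_of_test _ (contDiff_partial hφ i).continuous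
      (hasCompactSupport_partial hc i)

/-- A stationary test function, cut off in time. -/
theorem exists_isTestFunction {S : ℝ≥0∞} {τ : ℝ} (hτ : τ ∈ timeInterval S)
    (hφ : ContDiff ℝ ∞ φ) (hc : HasCompactSupport φ) :
    ∃ ψ : ℝ → Space n → ℝ, IsTestFunction S ψ ∧ (∀ s ∈ Icc 0 τ, ψ s = φ) ∧
      ∀ s ∈ Icc 0 τ, ∀ x, timeDeriv ψ s x = 0 := by
  obtain ⟨τ', hτ', hlt⟩ := exists_gt_mem_timeInterval hτ
  have hτ0 := hτ.1
  -- The inner radius lies strictly above τ, so the cutoff is constant near every s ∈ [0, τ],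
  -- including s = τ; the outer radius τ' is still an admissible time.
  let θ : ContDiffBump (0 : ℝ) := ⟨(τ + τ') / 2, τ', by linarith, by linarith⟩
  have hone : ∀ s ∈ Icc 0 τ, ∀ᶠ r in nhds s, θ r = 1 := by
    intro s hs
    have : s ∈ Metric.ball (0 : ℝ) ((τ + τ') / 2) := by
      rw [mem_ball_zero_iff, Real.norm_eq_abs, abs_of_nonneg hs.1]
      linarith [hs.2]
    filter_upwards [Metric.isOpen_ball.mem_nhds this] with r hr
    exact θ.one_of_mem_closedBall (Metric.ball_subset_closedBall hr)
  have hsupp : tsupport (fun z : ℝ × Space n => θ z.1 * φ z.2)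
      ⊆ tsupport θ ×ˢ tsupport φ := by
    refine closure_minimal (fun z hz => ⟨subset_tsupport _ ?_, subset_tsupport _ ?_⟩)
      ((isClosed_tsupport _).prod (isClosed_tsupport _))
    · exact left_ne_zero_of_mul hz
    · exact right_ne_zero_of_mul hz
  refine ⟨fun s x => θ s * φ x, ⟨?_, ?_, ?_⟩, fun s hs => ?_, fun s hs x => ?_⟩
  · exact (θ.contDiff.comp contDiff_fst).mul (hφ.comp contDiff_snd)
  · exact (θ.hasCompactSupport.isCompact.prod hc.isCompact).of_isClosed_subset
      (isClosed_tsupport _) hsupp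
  · intro z hz
    have h1 := (hsupp hz).1
    rw [θ.tsupport_eq, mem_closedBall_zero_iff, Real.norm_eq_abs] at h1
    have h2 : z.1 ≤ τ' := (le_abs_self _).trans h1
    exact (ENNReal.ofReal_le_ofReal h2).trans_lt hτ'.2
  · ext x
    simp only [(hone s hs).self_of_nhds, one_mul]
  · unfold timeDeriv
    have : (fun r => θ r * φ x) =ᶠ[nhds s] fun _ => φ x := by
      filter_upwards [hone s hs] with r hr
      rw [hr, one_mul]
    rw [this.deriv_eq, deriv_const]

end Test

/-! ### The differential equation for moments of a solution -/

section Solution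

variable {n : ℕ} {β p ε R : ℝ} {u₀ : Sobolev n 2} {u₁ : Sobolev n 1} {u₂ : L2 n} {S : ℝ≥0∞}
  {u : ℝ → Space n → ℝ} {V₂ : ℝ → Sobolev n 2} {V₁ : ℝ → Sobolev n 1} {V₀ : ℝ → L2 n}

theorem ae_eq_zero_of_cone (hsol : IsEnergySolutionVia β p ε u₀ u₁ u₂ S u V₂ V₁ V₀)
    (hcone : SupportedInCone R S u) (s₀ : SupportedInBall R (fn u₀)) {t : ℝ}
    (ht : t ∈ timeInterval S) : SupportedInBall (R + t) (u t) := by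
  rcases ht.1.eq_or_lt with h | h
  · subst h
    have h1 := hsol.eq₂ 0 ht
    rw [hsol.init₀] at h1
    have h2 : fn (ε • u₀) = ε • fn u₀ := rfl
    rw [h2] at h1
    have h3 := Lp.coeFn_smul ε (fn u₀)
    unfold SupportedInBall at s₀ ⊢
    filter_upwards [h1, h3, s₀] with x hx1 hx3 hx0 hx
    rw [add_zero] at hx
    rw [hx1, hx3, Pi.smul_apply, hx0 hx, smul_zero]
  · exact hcone t h ht.2

/-- The moment `t ↦ ∫ u(t) φ` of an energy solution against an eigenfunction `φ` of the
Laplacian on the support of `u`. -/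
theorem exists_moment_derivatives (hS : 0 < S)
    (hsol : IsEnergySolutionVia β p ε u₀ u₁ u₂ S u V₂ V₁ V₀)
    (hcone : SupportedInCone R S u) (s₀ : SupportedInBall R (fn u₀))
    {τ : ℝ} (hτ : τ ∈ timeInterval S) {φ : Space n → ℝ} (hφ : ContDiff ℝ ∞ φ)
    (hc : HasCompactSupport φ) {l : ℝ}
    (hl : ∀ x ∈ Metric.closedBall (0 : Space n) (R + τ), lap φ x = l * φ x) :
    ∃ G₁ G₂ : ℝ → ℝ,
      (∀ t ∈ Icc 0 τ, HasDerivWithinAt (fun t => ∫ x, u t x * φ x) (G₁ t) (Icc 0 τ) t) ∧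
      (∀ t ∈ Icc 0 τ, HasDerivWithinAt G₁ (G₂ t) (Icc 0 τ) t) ∧
      (∫ x, u 0 x * φ x) = ε * ∫ x, fn u₀ x * φ x ∧
      G₁ 0 = ε * ∫ x, fn u₁ x * φ x ∧
      G₂ 0 = ε * ∫ x, u₂ x * φ x ∧
      ∀ t ∈ Icc 0 τ, β * G₂ t + G₁ t - l * (β * ((∫ x, u t x * φ x) - ∫ x, u 0 x * φ x)
        + ∫ s in (0 : ℝ)..t, ∫ x, u s x * φ x)
        = β * G₂ 0 + G₁ 0 + ∫ s in (0 : ℝ)..t, ∫ x, |u s x| ^ p * φ x := by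
  set I := timeInterval S with hI
  have hud : UniqueDiffOn ℝ I := uniqueDiffOn_timeInterval hS
  have hsub : Icc 0 τ ⊆ I := timeInterval_subset hτ
  have h0τ : (0 : ℝ) ∈ Icc 0 τ := ⟨le_rfl, hτ.1⟩
  have mφ := memLp_test hφ hc
  have ml := memLp_lap hφ hc
  set w := derivWithin V₀ I with hw
  set z := iteratedDerivWithin 2 V₀ I with hz
  have hz' : z = derivWithin w I := by
    rw [hz, iteratedDerivWithin_succ, iteratedDerivWithin_one]
  have hC2 : DifferentiableOn ℝ V₀ I ∧ ContDiffOn ℝ 1 w I := by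
    have h2 : ContDiffOn ℝ (1 + 1) V₀ I := by
      rw [one_add_one_eq_two]
      exact hsol.cont₀
    obtain ⟨h3, -, h4⟩ := (contDiffOn_succ_iff_derivWithin hud).1 h2
    exact ⟨h3, h4⟩
  have hV₀ : ∀ t ∈ Icc 0 τ, HasDerivWithinAt V₀ (w t) (Icc 0 τ) t := fun t ht =>
    (hC2.1 t (hsub ht)).hasDerivWithinAt.mono hsub
  have hw' : ∀ t ∈ Icc 0 τ, HasDerivWithinAt w (z t) (Icc 0 τ) t := fun t ht => by
    rw [hz']
    exact ((hC2.2.differentiableOn one_ne_zero) t (hsub ht)).hasDerivWithinAt.mono hsub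
  have hV₁₀ : ∀ t ∈ I, fn (V₁ t) = V₀ t := fun t ht =>
    Lp.ext ((hsol.eq₁ t ht).symm.trans (hsol.eq₀ t ht))
  have hwfn : ∀ t ∈ I, fn (derivWithin V₁ I t) = w t := by
    intro t ht
    have h1 := ((hsol.cont₁.differentiableOn one_ne_zero) t ht).hasDerivWithinAt
    have h2 := (fnL n 1).hasFDerivAt.comp_hasDerivWithinAt t h1
    have h3 : HasDerivWithinAt V₀ (fnL n 1 (derivWithin V₁ I t)) I t :=
      h2.congr (fun s hs => (hV₁₀ s hs).symm) (hV₁₀ t ht).symm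
    exact (h3.derivWithin (hud t ht)).symm
  have hG : ∀ t ∈ Icc 0 τ, ∫ x, u t x * φ x = pair mφ (V₀ t) := by
    intro t ht
    rw [pair_apply]
    refine integral_congr_ae ?_
    filter_upwards [hsol.eq₀ t (hsub ht)] with x hx
    rw [hx]
  -- The eigenvalue relation holds only on B_{R+τ}; the cone condition makes u(t) vanish elsewhere.
  have hH : ∀ t ∈ Icc 0 τ, pair ml (V₀ t) = l * ∫ x, u t x * φ x := by
    intro t ht
    rw [pair_apply, ← integral_const_mul]
    refine integral_congr_ae ?_
    filter_upwards [hsol.eq₀ t (hsub ht), ae_eq_zero_of_cone hsol hcone s₀ (hsub ht)] with x hx hx0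
    rw [← hx]
    by_cases hxb : x ∈ Metric.closedBall (0 : Space n) (R + t)
    · rw [hl x (Metric.closedBall_subset_closedBall (by linarith [ht.2]) hxb)]
      ring
    · rw [hx0 hxb]
      ring
  have hwc : ContinuousOn w (Icc 0 τ) := fun t ht => (hw' t ht).continuousWithinAt
  have hV₀c : ContinuousOn V₀ (Icc 0 τ) := fun t ht => (hV₀ t ht).continuousWithinAt
  have hinit₁ : pair mφ (w 0) = ε * ∫ x, fn u₁ x * φ x := by
    rw [← hwfn 0 (hsub h0τ), hsol.init₁]
    have : fn (ε • u₁) = ε • fn u₁ := rfl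
    rw [this, map_smul, pair_apply, smul_eq_mul]
  have hinit₂ : pair mφ (z 0) = ε * ∫ x, u₂ x * φ x := by
    rw [hz, hsol.init₂, map_smul, pair_apply, smul_eq_mul]
  refine ⟨fun t => pair mφ (w t), fun t => pair mφ (z t), fun t ht => ?_, fun t ht => ?_, ?_,
    hinit₁, hinit₂, fun t ht => ?_⟩
  · exact ((pair mφ).hasFDerivAt.comp_hasDerivWithinAt t (hV₀ t ht)).congr hG (hG t ht)
  · exact (pair mφ).hasFDerivAt.comp_hasDerivWithinAt t (hw' t ht)
  · have h1 := hsol.eq₂ 0 (hsub h0τ)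
    rw [hsol.init₀] at h1
    have : fn (ε • u₀) = ε • fn u₀ := rfl
    rw [this] at h1
    rw [← integral_const_mul]
    refine integral_congr_ae ?_
    filter_upwards [h1, Lp.coeFn_smul ε (fn u₀)] with x hx1 hx2
    rw [hx1, hx2, Pi.smul_apply, smul_eq_mul, mul_assoc]
  · obtain ⟨ψ, hψ, hψφ, hψt⟩ := exists_isTestFunction hτ hφ hc
    have hid := hsol.identity ψ hψ t (hsub ht)
    have hsub' : uIcc 0 t ⊆ Icc 0 τ := by
      rw [uIcc_of_le ht.1]
      exact Icc_subset_Icc_right ht.2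
    -- The term with ∇u_t contributes -∫ u_t Δφ, an exact time derivative, so its time integral
    -- reduces to boundary values.
    have k1 : ∫ s in (0 : ℝ)..t, ∫ x,
        ((∑ i, weakPartial (derivWithin V₁ I s) i x * spaceDeriv ψ i s x)
          - z s x * timeDeriv ψ s x)
        = -(pair ml (V₀ t) - pair ml (V₀ 0)) := by
      have : ∀ s ∈ uIcc 0 t, ∫ x,
          ((∑ i, weakPartial (derivWithin V₁ I s) i x * spaceDeriv ψ i s x)
          - z s x * timeDeriv ψ s x) = -pair ml (w s) := by
        intro s hs
        simp only [hψt s (hsub' hs), spaceDeriv, hψφ s (hsub' hs), mul_zero, sub_zero]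
        rw [integral_gradient_mul _ hφ hc, hwfn s (hsub (hsub' hs)), pair_apply]
      rw [intervalIntegral.integral_congr this, intervalIntegral.integral_neg]
      congr 1
      refine intervalIntegral.integral_eq_sub_of_hasDeriv_right_of_le
        (f := fun s => pair ml (V₀ s)) ht.1 ?_ ?_ ?_
      · exact (pair ml).continuous.comp_continuousOn
          (hV₀c.mono (Icc_subset_Icc_right ht.2))
      · intro s hs
        have hs' : s ∈ Icc 0 τ := ⟨hs.1.le, hs.2.le.trans ht.2⟩
        have h1 := (pair ml).hasFDerivAt.comp_hasDerivWithinAt s (hV₀ s hs')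
        exact (h1.hasDerivAt (Icc_mem_nhds hs.1 (hs.2.trans_le ht.2))).hasDerivWithinAt
      · exact ((pair ml).continuous.comp_continuousOn (hwc.mono hsub')).intervalIntegrable
    have k2 : ∫ s in (0 : ℝ)..t, ∫ x,
        ((∑ i, weakPartial (V₁ s) i x * spaceDeriv ψ i s x) - w s x * timeDeriv ψ s x)
        = -(l * ∫ s in (0 : ℝ)..t, ∫ x, u s x * φ x) := by
      rw [← intervalIntegral.integral_const_mul, ← intervalIntegral.integral_neg]
      refine intervalIntegral.integral_congr fun s hs => ?_
      simp only [hψt s (hsub' hs), spaceDeriv, hψφ s (hsub' hs), mul_zero, sub_zero]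
      rw [integral_gradient_mul _ hφ hc, hV₁₀ s (hsub (hsub' hs)), ← hH s (hsub' hs), pair_apply]
    have k3 : ∫ s in (0 : ℝ)..t, ∫ x, |u s x| ^ p * ψ s x
        = ∫ s in (0 : ℝ)..t, ∫ x, |u s x| ^ p * φ x :=
      intervalIntegral.integral_congr fun s hs => by simp only [hψφ s (hsub' hs)]
    rw [k1, k2, k3, hψφ t ht, hψφ 0 h0τ, hH t ht, hH 0 h0τ] at hid
    simp only [hinit₁, hinit₂]
    rw [pair_apply, pair_apply]
    linarith

end Solution

/-! ### Ordinary differential inequalities -/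

theorem monotoneOn_Icc_of_hasDerivWithinAt {f f' : ℝ → ℝ} {a b : ℝ}
    (hf : ∀ t ∈ Icc a b, HasDerivWithinAt f (f' t) (Icc a b) t)
    (h0 : ∀ t ∈ Icc a b, 0 ≤ f' t) : MonotoneOn f (Icc a b) :=
  monotoneOn_of_hasDerivWithinAt_nonneg (convex_Icc a b)
    (fun t ht => (hf t ht).continuousWithinAt)
    (fun t ht => (hf t (interior_subset ht)).mono interior_subset)
    (fun t ht => h0 t (interior_subset ht))

theorem hasDerivWithinAt_exp_mul {b t : ℝ} {s : Set ℝ} {f : ℝ → ℝ} (c : ℝ)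
    (hf : HasDerivWithinAt f b s t) :
    HasDerivWithinAt (fun x => Real.exp (c * x) * f x) (Real.exp (c * t) * (c * f t + b)) s t := by
  have h := (((hasDerivAt_id t).const_mul c).exp).hasDerivWithinAt (s := s)
  refine (h.mul hf).congr_deriv ?_
  simp only [id, mul_one]
  ring

/-- Exponential growth of a function `G` with `(β d/dt + 1)(G'' - G) ≥ 0`. -/
theorem exp_le_of_third_order {β τ : ℝ} (hβ : 0 < β) (hτ : 0 ≤ τ) {G G₁ G₂ M : ℝ → ℝ}
    (hG : ∀ t ∈ Icc 0 τ, HasDerivWithinAt G (G₁ t) (Icc 0 τ) t)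
    (hG₁ : ∀ t ∈ Icc 0 τ, HasDerivWithinAt G₁ (G₂ t) (Icc 0 τ) t)
    (h0 : 0 ≤ G 0) (h1 : 0 ≤ G₁ 0) (h2 : 0 ≤ G₂ 0)
    (hM : MonotoneOn M (Icc 0 τ)) (hM0 : 0 ≤ M 0)
    (heq : ∀ t ∈ Icc 0 τ, β * G₂ t + G₁ t - β * (G t - G 0) - ∫ s in (0 : ℝ)..t, G s
      = β * G₂ 0 + G₁ 0 + M t) :
    ∀ t ∈ Icc 0 τ, G 0 / (2 * (1 + β)) * Real.exp t ≤ G t := by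
  have hGc : ContinuousOn G (Icc 0 τ) := fun t ht => (hG t ht).continuousWithinAt
  have hP : ∀ t ∈ Icc 0 τ, HasDerivWithinAt (fun t => ∫ s in (0 : ℝ)..t, G s) (G t) (Icc 0 τ) t := by
    intro t ht
    have : Fact (t ∈ Icc 0 τ) := ⟨ht⟩
    refine intervalIntegral.integral_hasDerivWithinAt_right ?_ ?_ (hGc t ht)
    · refine (hGc.mono ?_).intervalIntegrable
      rw [uIcc_of_le ht.1]
      exact Icc_subset_Icc_right ht.2
    · exact hGc.stronglyMeasurableAtFilter_nhdsWithin measurableSet_Icc t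
  -- J is the primitive of G'' - G vanishing at 0; in terms of J the hypothesis is the first-order
  -- equation J + βJ' = const + M.
  set J : ℝ → ℝ := fun t => G₁ t - G₁ 0 - ∫ s in (0 : ℝ)..t, G s with hJ
  have hJd : ∀ t ∈ Icc 0 τ, HasDerivWithinAt J (G₂ t - G t) (Icc 0 τ) t := fun t ht =>
    ((hG₁ t ht).sub_const _).sub (hP t ht)
  have h00 : (0 : ℝ) ∈ Icc 0 τ := ⟨le_rfl, hτ⟩
  have hJ0 : J 0 = 0 := by simp [hJ]
  have hJeq : ∀ t ∈ Icc 0 τ, J t + β * (G₂ t - G t) = β * (G₂ 0 - G 0) + M t := by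
    intro t ht
    have := heq t ht
    simp only [hJ]
    linarith
  have hE : ∀ t ∈ Icc 0 τ, -G 0 * Real.exp (-(β⁻¹ * t)) ≤ G₂ t - G t := by
    intro t ht
    have hsub : Icc 0 t ⊆ Icc 0 τ := Icc_subset_Icc_right ht.2
    -- M is frozen at its endpoint value M t, so it need not be differentiated; M s ≤ M t gives the
    -- sign.
    have hmono : MonotoneOn (fun s => -(Real.exp (β⁻¹ * s) * (J s - (β * (G₂ 0 - G 0) + M t))))
        (Icc 0 t) := by
      refine monotoneOn_Icc_of_hasDerivWithinAt (fun s hs =>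
        (hasDerivWithinAt_exp_mul β⁻¹ (((hJd s (hsub hs)).mono hsub).sub_const _)).neg)
        fun s hs => ?_
      have h3 := hJeq s (hsub hs)
      have h4 : M s ≤ M t := hM (hsub hs) ht hs.2
      have h5 : G₂ s - G s = β⁻¹ * (β * (G₂ 0 - G 0) + M s - J s) := by
        rw [← h3]
        field_simp
        ring
      rw [h5]
      have h6 : β⁻¹ * (J s - (β * (G₂ 0 - G 0) + M t)) + β⁻¹ * (β * (G₂ 0 - G 0) + M s - J s)
          = -(β⁻¹ * (M t - M s)) := by ring
      rw [h6, mul_neg, neg_neg]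
      have : 0 ≤ M t - M s := by linarith
      positivity
    have h3 := hmono ⟨le_rfl, ht.1⟩ ⟨ht.1, le_rfl⟩ ht.1
    have h4 := hJeq t ht
    have h5 : 0 ≤ M t := hM0.trans (hM h00 ht ht.1)
    simp only [hJ0, mul_zero, Real.exp_zero, zero_sub, one_mul, neg_neg] at h3
    have h6 : J t - (β * (G₂ 0 - G 0) + M t) = -(β * (G₂ t - G t)) := by linarith
    rw [h6] at h3
    have h7 : -(β * G 0) ≤ β * (Real.exp (β⁻¹ * t) * (G₂ t - G t)) := by
      have : 0 ≤ β * G₂ 0 := by positivity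
      nlinarith
    have h8 : -G 0 ≤ Real.exp (β⁻¹ * t) * (G₂ t - G t) := by
      have : β * (-G 0) ≤ β * (Real.exp (β⁻¹ * t) * (G₂ t - G t)) := by linarith
      exact le_of_mul_le_mul_left this hβ
    have h9 := mul_le_mul_of_nonneg_right h8 (Real.exp_pos (-(β⁻¹ * t))).le
    have h10 : Real.exp (β⁻¹ * t) * (G₂ t - G t) * Real.exp (-(β⁻¹ * t)) = G₂ t - G t := by
      rw [mul_right_comm, ← Real.exp_add, add_neg_cancel, Real.exp_zero, one_mul]
    linarith
  -- first integration
  have hK : ∀ t ∈ Icc 0 τ, G 0 / (1 + β) * Real.exp t ≤ G₁ t + G t := by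
    intro t ht
    -- Since (e^{-s}(G' + G))' = e^{-s}(G'' - G), the bound `hE` costs at most G(0)/(1 + β⁻¹) in
    -- total, and G(0)/(1 + β) survives.
    have hmono : MonotoneOn (fun s => Real.exp (-1 * s) * (G₁ s + G s)
        - G 0 / (1 + β⁻¹) * Real.exp (-(1 + β⁻¹) * s)) (Icc 0 τ) := by
      refine monotoneOn_Icc_of_hasDerivWithinAt (fun s hs =>
        (hasDerivWithinAt_exp_mul (-1) ((hG₁ s hs).add (hG s hs))).sub
        ((((hasDerivAt_id s).const_mul (-(1 + β⁻¹))).exp.const_mul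
          (G 0 / (1 + β⁻¹))).hasDerivWithinAt)) fun s hs => ?_
      have h3 := hE s hs
      have h4 : G 0 / (1 + β⁻¹) * (Real.exp (-(1 + β⁻¹) * id s) * (-(1 + β⁻¹) * 1))
          = -(Real.exp (-1 * s) * (G 0 * Real.exp (-(β⁻¹ * s)))) := by
        have : Real.exp (-(1 + β⁻¹) * id s) = Real.exp (-1 * s) * Real.exp (-(β⁻¹ * s)) := by
          rw [← Real.exp_add]
          congr 1
          simp only [id]
          ring
        rw [this]
        field_simp
      rw [h4, sub_neg_eq_add, ← mul_add]
      refine mul_nonneg (Real.exp_pos _).le ?_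
      simp only [Pi.add_apply]
      linarith
    have h3 := hmono h00 ht ht.1
    simp only [mul_zero, Real.exp_zero, one_mul, mul_one] at h3
    have h4 : 0 ≤ G 0 / (1 + β⁻¹) * Real.exp (-(1 + β⁻¹) * t) := by positivity
    have h5 : G 0 - G 0 / (1 + β⁻¹) = G 0 / (1 + β) := by
      field_simp
      ring
    have h6 : G 0 / (1 + β) ≤ Real.exp (-1 * t) * (G₁ t + G t) := by linarith
    have h7 := mul_le_mul_of_nonneg_right h6 (Real.exp_pos t).le
    have h8 : Real.exp (-1 * t) * (G₁ t + G t) * Real.exp t = G₁ t + G t := by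
      rw [mul_right_comm, ← Real.exp_add]
      simp
    linarith
  intro t ht
  -- Second integration: (e^s G)' = e^s (G' + G) ≥ G(0)/(1 + β) · e^{2s}.
  have hmono : MonotoneOn (fun s => Real.exp (1 * s) * G s
      - G 0 / (2 * (1 + β)) * Real.exp (2 * s)) (Icc 0 τ) := by
    refine monotoneOn_Icc_of_hasDerivWithinAt (fun s hs =>
      (hasDerivWithinAt_exp_mul 1 (hG s hs)).sub
      ((((hasDerivAt_id s).const_mul 2).exp.const_mul (G 0 / (2 * (1 + β)))).hasDerivWithinAt))
      fun s hs => ?_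
    have h3 := hK s hs
    have h4 : G 0 / (2 * (1 + β)) * (Real.exp (2 * id s) * (2 * 1))
        = Real.exp (1 * s) * (G 0 / (1 + β) * Real.exp s) := by
      have : Real.exp (2 * id s) = Real.exp (1 * s) * Real.exp s := by
        rw [← Real.exp_add]
        congr 1
        simp only [id]
        ring
      rw [this]
      field_simp
    rw [h4, ← mul_sub]
    refine mul_nonneg (Real.exp_pos _).le ?_
    linarith
  have h3 := hmono h00 ht ht.1
  simp only [mul_zero, Real.exp_zero, one_mul, mul_one] at h3
  have h4 : G 0 / (2 * (1 + β)) ≤ G 0 := div_le_self h0 (by linarith)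
  have h5 : G 0 / (2 * (1 + β)) * Real.exp (2 * t) ≤ Real.exp t * G t := by linarith
  have h6 : Real.exp (2 * t) = Real.exp t * Real.exp t := by
    rw [← Real.exp_add]
    congr 1
    ring
  rw [h6] at h5
  refine le_of_mul_le_mul_left ?_ (Real.exp_pos t)
  linarith

/-- Persistence of `U' ≥ 0` for `β U'' + U' ≥ 0`. -/
theorem deriv_nonneg_of_second_order {β a b : ℝ} (hβ : 0 < β) {U₁ U₂ : ℝ → ℝ}
    (hU₁ : ∀ t ∈ Icc a b, HasDerivWithinAt U₁ (U₂ t) (Icc a b) t)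
    (h1 : 0 ≤ U₁ a) (hW : ∀ t ∈ Icc a b, 0 ≤ β * U₂ t + U₁ t) :
    ∀ t ∈ Icc a b, 0 ≤ U₁ t := by
  intro t ht
  have hmono : MonotoneOn (fun s => Real.exp (β⁻¹ * s) * U₁ s) (Icc a b) := by
    refine monotoneOn_Icc_of_hasDerivWithinAt
      (fun s hs => hasDerivWithinAt_exp_mul β⁻¹ (hU₁ s hs)) fun s hs => ?_
    have h2 := hW s hs
    have h3 : β⁻¹ * U₁ s + U₂ s = β⁻¹ * (β * U₂ s + U₁ s) := by
      field_simp
      ring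
    rw [h3]
    positivity
  have h2 := hmono ⟨le_rfl, ht.1.trans ht.2⟩ ht ht.1
  have h3 : 0 ≤ Real.exp (β⁻¹ * t) * U₁ t := le_trans (by positivity) h2
  exact nonneg_of_mul_nonneg_right h3 (Real.exp_pos _)

/-- Growth on an interval of length `h` for `β U'' + U' ≥ γ (t - a)`. -/
theorem cube_div_le_of_second_order {β γ a h : ℝ} (hβ : 0 < β) (hγ : 0 ≤ γ) (hh : 0 ≤ h)
    {U U₁ U₂ : ℝ → ℝ}
    (hU : ∀ t ∈ Icc a (a + h), HasDerivWithinAt U (U₁ t) (Icc a (a + h)) t)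
    (hU₁ : ∀ t ∈ Icc a (a + h), HasDerivWithinAt U₁ (U₂ t) (Icc a (a + h)) t)
    (h0 : 0 ≤ U a) (h1 : 0 ≤ U₁ a)
    (hW : ∀ t ∈ Icc a (a + h), γ * (t - a) ≤ β * U₂ t + U₁ t) :
    γ * (h ^ 3 / (3 * (2 * β + h))) ≤ U (a + h) := by
  -- the first derivative dominates the subsolution `γ s² / (2β + s)`
  have hw : ∀ t ∈ Icc a (a + h), 0 ≤ U₁ t - γ * ((t - a) ^ 2 / (2 * β + (t - a))) := by
    refine deriv_nonneg_of_second_order hβ (U₂ := fun t => U₂ t - γ *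
      ((2 * (t - a) * (2 * β + (t - a)) - (t - a) ^ 2) / (2 * β + (t - a)) ^ 2)) ?_ ?_ ?_
    · intro t ht
      have hs : 0 ≤ t - a := by linarith [ht.1]
      have hne : 2 * β + (t - a) ≠ 0 := by positivity
      have hd : HasDerivAt (fun t => t - a) 1 t := (hasDerivAt_id t).sub_const a
      refine (hU₁ t ht).sub (HasDerivAt.hasDerivWithinAt (HasDerivAt.const_mul γ ?_))
      refine ((hd.pow 2).div (hd.const_add (2 * β)) hne).congr_deriv ?_
      simp
    · simpa using h1
    · intro t ht
      have hs : 0 ≤ t - a := by linarith [ht.1]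
      set s := t - a
      have h2 := hW t ht
      -- For w = s²/(2β + s) this is βw' + w ≤ s. The profile interpolates between s²/(2β) for short
      -- times and s for long times.
      have h3 : β * ((2 * s * (2 * β + s) - s ^ 2) / (2 * β + s) ^ 2) + s ^ 2 / (2 * β + s) ≤ s := by
        have : 0 < 2 * β + s := by positivity
        have h4 : s - (β * ((2 * s * (2 * β + s) - s ^ 2) / (2 * β + s) ^ 2) + s ^ 2 / (2 * β + s))
            = β * s ^ 2 / (2 * β + s) ^ 2 := by
          field_simp
          ring
        have h5 : 0 ≤ β * s ^ 2 / (2 * β + s) ^ 2 := by positivity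
        linarith
      nlinarith [mul_le_mul_of_nonneg_left h3 hγ]
  have hmono : MonotoneOn (fun t => U t - γ * ((t - a) ^ 3 / (3 * (2 * β + (t - a)))))
      (Icc a (a + h)) := by
    refine monotoneOn_Icc_of_hasDerivWithinAt (f' := fun t => U₁ t - γ *
      ((3 * (t - a) ^ 2 * (3 * (2 * β + (t - a))) - (t - a) ^ 3 * 3)
        / (3 * (2 * β + (t - a))) ^ 2)) (fun t ht => ?_) fun t ht => ?_
    · have hs : 0 ≤ t - a := by linarith [ht.1]
      have hne : 3 * (2 * β + (t - a)) ≠ 0 := by positivity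
      have hd : HasDerivAt (fun t => t - a) 1 t := (hasDerivAt_id t).sub_const a
      refine (hU t ht).sub (HasDerivAt.hasDerivWithinAt (HasDerivAt.const_mul γ ?_))
      refine ((hd.pow 3).div ((hd.const_add (2 * β)).const_mul 3) hne).congr_deriv ?_
      simp
    · have hs : 0 ≤ t - a := by linarith [ht.1]
      have h2 := hw t ht
      set s := t - a
      have h3 : (3 * s ^ 2 * (3 * (2 * β + s)) - s ^ 3 * 3) / (3 * (2 * β + s)) ^ 2
          ≤ s ^ 2 / (2 * β + s) := by
        have : 0 < 2 * β + s := by positivity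
        rw [div_le_div_iff₀ (by positivity) this]
        have : 0 ≤ s ^ 3 * (2 * β + s) := by positivity
        nlinarith
      nlinarith [mul_le_mul_of_nonneg_left h3 hγ]
  have h2 := hmono ⟨le_rfl, by linarith⟩ ⟨by linarith, le_rfl⟩ (by linarith : a ≤ a + h)
  simp only [sub_self, add_sub_cancel_left] at h2
  have h3 : γ * (0 ^ 3 / (3 * (2 * β + 0))) = 0 := by simp
  linarith

/-! ### Hölder's inequality and lower bounds for the nonlinearity -/

/-- Hölder on the ball carrying f. Integrability of |f|^p is essential: otherwise the integral on
the right would be 0 by convention. -/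
theorem moment_rpow_le {n : ℕ} {p q ρ : ℝ} (hpq : p.HolderConjugate q) {f φ : Space n → ℝ}
    (hf : AEStronglyMeasurable f) (hi : IntegrableOn (fun x => |f x| ^ p) (Metric.closedBall 0 ρ))
    (h0 : SupportedInBall ρ f) (hφ : Continuous φ) (hφ0 : ∀ x, 0 ≤ φ x)
    (hpos : 0 ≤ ∫ x, f x * φ x) :
    (∫ x, f x * φ x) ^ p ≤
      (∫ x, |f x| ^ p) * (∫ x in Metric.closedBall (0 : Space n) ρ, φ x ^ q) ^ (p - 1) := by
  have hp := hpq.pos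
  have hq := hpq.symm.pos
  have e1 : ∫ x, f x * φ x = ∫ x in Metric.closedBall (0 : Space n) ρ, f x * φ x := by
    refine (setIntegral_eq_integral_of_ae_compl_eq_zero ?_).symm
    filter_upwards [h0] with x hx hxb
    rw [hx hxb, zero_mul]
  have e2 : ∫ x, |f x| ^ p = ∫ x in Metric.closedBall (0 : Space n) ρ, |f x| ^ p := by
    refine (setIntegral_eq_integral_of_ae_compl_eq_zero ?_).symm
    filter_upwards [h0] with x hx hxb
    rw [hx hxb, abs_zero, Real.zero_rpow hp.ne']
  have hA : 0 ≤ ∫ x in Metric.closedBall (0 : Space n) ρ, |f x| ^ p :=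
    integral_nonneg fun x => by positivity
  have hB : 0 ≤ ∫ x in Metric.closedBall (0 : Space n) ρ, φ x ^ q :=
    integral_nonneg fun x => Real.rpow_nonneg (hφ0 x) q
  have m1 : MemLp (fun x => |f x|) (ENNReal.ofReal p)
      (volume.restrict (Metric.closedBall (0 : Space n) ρ)) := by
    refine (integrable_norm_rpow_iff (f := fun x => |f x|) hf.restrict.norm (by simpa using hp)
      ENNReal.ofReal_ne_top).1 ?_
    simp only [ENNReal.toReal_ofReal hp.le, Real.norm_eq_abs, abs_abs]
    exact hi
  have m2 : MemLp φ (ENNReal.ofReal q)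
      (volume.restrict (Metric.closedBall (0 : Space n) ρ)) := by
    rw [← integrable_norm_rpow_iff hφ.aestronglyMeasurable (by simpa using hq)
      ENNReal.ofReal_ne_top, ENNReal.toReal_ofReal hq.le]
    exact (hφ.norm.rpow_const fun x => Or.inr hq.le).continuousOn.integrableOn_compact
      (isCompact_closedBall _ _)
  have h := integral_mul_le_Lp_mul_Lq_of_nonneg hpq
    (Filter.Eventually.of_forall fun x => abs_nonneg (f x)) (Filter.Eventually.of_forall hφ0) m1 m2
  have h1 : ∫ x in Metric.closedBall (0 : Space n) ρ, f x * φ x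
      ≤ ∫ x in Metric.closedBall (0 : Space n) ρ, |f x| * φ x := by
    have : |∫ x in Metric.closedBall (0 : Space n) ρ, f x * φ x|
        ≤ ∫ x in Metric.closedBall (0 : Space n) ρ, |f x * φ x| := abs_integral_le_integral_abs
    simp only [abs_mul, abs_of_nonneg (hφ0 _)] at this
    exact (le_abs_self _).trans this
  rw [e1] at hpos ⊢
  rw [e2]
  calc _ ≤ ((∫ x in Metric.closedBall (0 : Space n) ρ, |f x| ^ p) ^ (1 / p)
        * (∫ x in Metric.closedBall (0 : Space n) ρ, φ x ^ q) ^ (1 / q)) ^ p :=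
        Real.rpow_le_rpow hpos (h1.trans h) hp.le
    _ = _ := by
      rw [Real.mul_rpow (by positivity) (by positivity), ← Real.rpow_mul hA, ← Real.rpow_mul hB]
      have a1 : 1 / p * p = 1 := by field_simp
      have a2 : 1 / q * p = p - 1 := by
        have := hpq.sub_one_mul_conj
        field_simp
        linarith
      rw [a1, a2, Real.rpow_one]

section Solution

variable {n : ℕ} {β p ε R : ℝ} {u₀ : Sobolev n 2} {u₁ : Sobolev n 1} {u₂ : L2 n} {S : ℝ≥0∞}
  {u : ℝ → Space n → ℝ} {V₂ : ℝ → Sobolev n 2} {V₁ : ℝ → Sobolev n 1} {V₀ : ℝ → L2 n}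

theorem integrable_rpow_mul (hsol : IsEnergySolutionVia β p ε u₀ u₁ u₂ S u V₂ V₁ V₀)
    {τ : ℝ} (hτ : τ ∈ timeInterval S) (ρ : ℝ) {φ : Space n → ℝ} (hφ : Continuous φ) :
    Integrable (fun z : ℝ × Space n => |u z.1 z.2| ^ p * φ z.2)
      ((volume.restrict (Icc 0 τ)).prod (volume.restrict (Metric.closedBall (0 : Space n) ρ))) := by
  rw [Measure.prod_restrict]
  have hK : IsCompact (Icc 0 τ ×ˢ Metric.closedBall (0 : Space n) ρ) :=
    isCompact_Icc.prod (isCompact_closedBall _ _)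
  have h1 := hsol.locInt.integrableOn_compact_subset
    (prod_mono (timeInterval_subset hτ) (subset_univ _)) hK
  exact h1.mul_continuousOn (hφ.comp continuous_snd).continuousOn hK

theorem integral_rpow_mul_eq (hp : 0 < p)
    (hsol : IsEnergySolutionVia β p ε u₀ u₁ u₂ S u V₂ V₁ V₀)
    (hcone : SupportedInCone R S u) (s₀ : SupportedInBall R (fn u₀)) {t τ : ℝ}
    (ht : t ∈ timeInterval S) (htτ : t ≤ τ) (φ : Space n → ℝ) :
    ∫ x, |u t x| ^ p * φ x = ∫ x in Metric.closedBall (0 : Space n) (R + τ), |u t x| ^ p * φ x := by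
  refine (setIntegral_eq_integral_of_ae_compl_eq_zero ?_).symm
  filter_upwards [ae_eq_zero_of_cone hsol hcone s₀ ht] with x hx hxb
  rw [hx fun h => hxb (Metric.closedBall_subset_closedBall (by linarith) h), abs_zero,
    Real.zero_rpow hp.ne', zero_mul]

theorem integrableOn_moment_rpow (hp : 0 < p)
    (hsol : IsEnergySolutionVia β p ε u₀ u₁ u₂ S u V₂ V₁ V₀)
    (hcone : SupportedInCone R S u) (s₀ : SupportedInBall R (fn u₀))
    {τ : ℝ} (hτ : τ ∈ timeInterval S) {φ : Space n → ℝ} (hφ : Continuous φ) :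
    IntegrableOn (fun s => ∫ x, |u s x| ^ p * φ x) (Icc 0 τ) := by
  refine (integrable_rpow_mul hsol hτ (R + τ) hφ).integral_prod_left.congr ?_
  filter_upwards [ae_restrict_mem measurableSet_Icc] with s hs
  exact (integral_rpow_mul_eq hp hsol hcone s₀ (timeInterval_subset hτ hs) hs.2 φ).symm

/-- Local integrability in space-time controls slices only through Fubini, so the Hölder bounds
below hold for almost every time. -/
theorem ae_integrableOn_rpow (hsol : IsEnergySolutionVia β p ε u₀ u₁ u₂ S u V₂ V₁ V₀)
    {τ : ℝ} (hτ : τ ∈ timeInterval S) (ρ : ℝ) :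
    ∀ᵐ s, s ∈ Icc 0 τ → IntegrableOn (fun x => |u s x| ^ p) (Metric.closedBall 0 ρ) := by
  have h := (integrable_rpow_mul hsol hτ ρ (φ := fun _ => 1) continuous_const).prod_right_ae
  rw [ae_restrict_iff' measurableSet_Icc] at h
  filter_upwards [h] with s hs hsI
  have h1 := hs hsI
  simp only [mul_one] at h1
  exact h1

theorem aestronglyMeasurable_slice (hsol : IsEnergySolutionVia β p ε u₀ u₁ u₂ S u V₂ V₁ V₀)
    {t : ℝ} (ht : t ∈ timeInterval S) : AEStronglyMeasurable (u t) :=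
  (Lp.aestronglyMeasurable (V₀ t)).congr (hsol.eq₀ t ht).symm

/-- The spatial mean `U` of an energy solution and the power `N(s) = ∫ |u(s)|^p` of its norm:
the ordinary differential equation and the two lower bounds for `N`. -/
theorem exists_mean_inequalities (hn : 1 ≤ n) (hp : 1 < p) (hβ : 0 < β) (hR : 0 < R) (hε : 0 < ε)
    {q C : ℝ} (hpq : p.HolderConjugate q)
    (hC : ∀ ρ : ℝ, 0 ≤ ρ → ∫ x in Metric.closedBall (0 : Space n) ρ, radialExp x ^ q
        ≤ C * (1 + ρ) ^ (((n : ℝ) - 1) * (1 - q / 2)) * Real.exp (q * ρ))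
    (h₀ : ∀ᵐ x, 0 ≤ fn u₀ x) (h₁ : ∀ᵐ x, 0 ≤ fn u₁ x) (h₂ : ∀ᵐ x, 0 ≤ u₂ x)
    (s₀ : SupportedInBall R (fn u₀)) (hS : 0 < S)
    (hsol : IsEnergySolutionVia β p ε u₀ u₁ u₂ S u V₂ V₁ V₀)
    (hcone : SupportedInCone R S u) {τ : ℝ} (hτ : τ ∈ timeInterval S) :
    ∃ U U₁ U₂ N : ℝ → ℝ,
      (∀ t ∈ Icc 0 τ, HasDerivWithinAt U (U₁ t) (Icc 0 τ) t) ∧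
      (∀ t ∈ Icc 0 τ, HasDerivWithinAt U₁ (U₂ t) (Icc 0 τ) t) ∧
      0 ≤ U 0 ∧ 0 ≤ U₁ 0 ∧ 0 ≤ U₂ 0 ∧ IntegrableOn N (Icc 0 τ) ∧ (∀ s, 0 ≤ N s) ∧
      (∀ t ∈ Icc 0 τ, β * U₂ t + U₁ t = β * U₂ 0 + U₁ 0 + ∫ s in (0 : ℝ)..t, N s) ∧
      (∀ᵐ s, s ∈ Icc 0 τ → 0 ≤ U s → U s ^ p ≤
        N s * (volume.real (Metric.closedBall (0 : Space n) (R + s))) ^ (p - 1)) ∧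
      (∀ᵐ s, s ∈ Icc 0 τ →
        (ε * (∫ x in Metric.closedBall 0 R, fn u₀ x * radialExp x) / (2 * (1 + β))
          * Real.exp s) ^ p ≤
        N s * (C * (1 + (R + s)) ^ (((n : ℝ) - 1) * (1 - q / 2)) * Real.exp (q * (R + s)))
          ^ (p - 1)) := by
  have hp0 : 0 < p := by linarith
  have hτ0 := hτ.1
  -- Neither 1 nor Φ has compact support. The cutoff equals 1 on a neighbourhood of B_{R+τ}, so it
  -- changes neither the moments nor the Laplacian there.
  let χ : ContDiffBump (0 : Space n) := ⟨R + τ + 1, R + τ + 2, by linarith, by linarith⟩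
  have hχ1 : ∀ x ∈ Metric.ball (0 : Space n) (R + τ + 1), χ x = 1 := fun x hx =>
    χ.one_of_mem_closedBall (Metric.ball_subset_closedBall hx)
  have hball : ∀ x ∈ Metric.closedBall (0 : Space n) (R + τ),
      x ∈ Metric.ball (0 : Space n) (R + τ + 1) := fun x hx =>
    Metric.closedBall_subset_ball (by linarith) hx
  have hlap : ∀ (ψ : Space n → ℝ), ∀ x ∈ Metric.closedBall (0 : Space n) (R + τ),
      lap (fun y => χ y * ψ y) x = lap ψ x := by
    intro ψ x hx
    have hev : (fun y => χ y * ψ y) =ᶠ[nhds x] ψ := by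
      filter_upwards [Metric.isOpen_ball.mem_nhds (hball x hx)] with y hy
      rw [hχ1 y hy, one_mul]
    unfold lap
    refine Finset.sum_congr rfl fun i _ => ?_
    have h2 : (fun y => fderiv ℝ (fun y => χ y * ψ y) y (e i))
        =ᶠ[nhds x] fun y => fderiv ℝ ψ y (e i) := by
      filter_upwards [hev.fderiv (𝕜 := ℝ)] with y hy
      rw [hy]
    rw [h2.fderiv_eq]
  have hint : ∀ (ψ : Space n → ℝ) {s : ℝ}, s ∈ Icc 0 τ → ∫ x, u s x * (χ x * ψ x)
      = ∫ x, u s x * ψ x := by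
    intro ψ s hs
    refine integral_congr_ae ?_
    filter_upwards [ae_eq_zero_of_cone hsol hcone s₀ (timeInterval_subset hτ hs)] with x hx
    by_cases hxb : x ∈ Metric.closedBall (0 : Space n) (R + s)
    · rw [hχ1 x (hball x (Metric.closedBall_subset_closedBall (by linarith [hs.2]) hxb)), one_mul]
    · rw [hx hxb, zero_mul, zero_mul]
  have hN : ∀ {s : ℝ}, s ∈ Icc 0 τ → ∫ x, |u s x| ^ p * χ x = ∫ x, |u s x| ^ p := by
    intro s hs
    refine integral_congr_ae ?_
    filter_upwards [ae_eq_zero_of_cone hsol hcone s₀ (timeInterval_subset hτ hs)] with x hx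
    by_cases hxb : x ∈ Metric.closedBall (0 : Space n) (R + s)
    · rw [hχ1 x (hball x (Metric.closedBall_subset_closedBall (by linarith [hs.2]) hxb)), mul_one]
    · rw [hx hxb, abs_zero, Real.zero_rpow hp0.ne', zero_mul]
  have hχl : ∀ x ∈ Metric.closedBall (0 : Space n) (R + τ), lap χ x = 0 * χ x := by
    intro x hx
    have h1 := hlap (fun _ => 1) x hx
    simp only [mul_one] at h1
    rw [show lap (χ : Space n → ℝ) x = lap (fun y => χ y) x from rfl, h1]
    simp [lap]
  have hmem : ∀ s ∈ Icc 0 τ, IntegrableOn (fun x => |u s x| ^ p) (Metric.closedBall 0 (R + τ)) →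
      IntegrableOn (fun x => |u s x| ^ p) (Metric.closedBall 0 (R + s)) := fun s hs h =>
    h.mono_set (Metric.closedBall_subset_closedBall (by linarith [hs.2]))
  -- The mean is the moment with eigenvalue l = 0.
  obtain ⟨U₁, U₂, hU, hU₁, hi0, hi1, hi2, heq⟩ := exists_moment_derivatives hS hsol hcone s₀ hτ
    χ.contDiff χ.hasCompactSupport hχl
  simp only [zero_mul, sub_zero] at heq
  -- the moment against the eigenfunction
  have hΦ := contDiff_radialExp hn
  have hφ : ContDiff ℝ ∞ fun x => χ x * radialExp x := χ.contDiff.mul hΦ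
  have hφc : HasCompactSupport fun x => χ x * radialExp x := χ.hasCompactSupport.mul_right
  have hΦ0 : ∀ x : Space n, 0 ≤ radialExp x := fun x => by linarith [one_le_radialExp hn x]
  have hφ0 : ∀ x, 0 ≤ χ x * radialExp x := fun x => mul_nonneg χ.nonneg (hΦ0 x)
  obtain ⟨G₁, G₂, hG, hG₁, hg0, hg1, hg2, hgeq⟩ := exists_moment_derivatives (l := 1) hS hsol hcone
    s₀ hτ hφ hφc (fun x hx => by
      rw [hlap _ x hx, lap_radialExp hn, hχ1 x (hball x hx)]
      ring)
  have hIφ := integrableOn_moment_rpow hp0 hsol hcone s₀ hτ hφ.continuous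
  have hexp := exp_le_of_third_order hβ hτ0 hG hG₁ (M := fun t => ∫ s in (0 : ℝ)..t,
      ∫ x, |u s x| ^ p * (χ x * radialExp x))
    (by
      rw [hg0]
      refine mul_nonneg hε.le (integral_nonneg_of_ae ?_)
      filter_upwards [h₀] with x hx using mul_nonneg hx (hφ0 x))
    (by
      rw [hg1]
      refine mul_nonneg hε.le (integral_nonneg_of_ae ?_)
      filter_upwards [h₁] with x hx using mul_nonneg hx (hφ0 x))
    (by
      rw [hg2]
      refine mul_nonneg hε.le (integral_nonneg_of_ae ?_)
      filter_upwards [h₂] with x hx using mul_nonneg hx (hφ0 x))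
    (by
      intro s hs t ht hst
      refine intervalIntegral.integral_mono_interval le_rfl hs.1 hst ?_ ?_
      · exact Filter.Eventually.of_forall fun r => integral_nonneg fun x =>
          mul_nonneg (by positivity) (hφ0 x)
      · rw [intervalIntegrable_iff_integrableOn_Icc_of_le ht.1]
        exact hIφ.mono_set (Icc_subset_Icc_right ht.2))
    (by simp)
    (fun t ht => by
      have := hgeq t ht
      linarith)
  have hg0' : ∫ x, u 0 x * (χ x * radialExp x)
      = ε * ∫ x in Metric.closedBall 0 R, fn u₀ x * radialExp x := by
    rw [hg0]
    congr 1
    rw [← setIntegral_eq_integral_of_ae_compl_eq_zero (s := Metric.closedBall 0 R)]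
    · refine setIntegral_congr_fun measurableSet_closedBall fun x hx => ?_
      rw [hχ1 x (hball x (Metric.closedBall_subset_closedBall (by linarith) hx)), one_mul]
    · filter_upwards [s₀] with x hx hxb
      rw [hx hxb, zero_mul]
  refine ⟨fun t => ∫ x, u t x * χ x, U₁, U₂, fun s => ∫ x, |u s x| ^ p * χ x, hU, hU₁, ?_, ?_, ?_,
    integrableOn_moment_rpow hp0 hsol hcone s₀ hτ χ.continuous, fun s => integral_nonneg fun x =>
      mul_nonneg (by positivity) χ.nonneg, heq, ?_, ?_⟩
  · change 0 ≤ ∫ x, u 0 x * χ x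
    rw [hi0]
    refine mul_nonneg hε.le (integral_nonneg_of_ae ?_)
    filter_upwards [h₀] with x hx using mul_nonneg hx χ.nonneg
  · rw [hi1]
    refine mul_nonneg hε.le (integral_nonneg_of_ae ?_)
    filter_upwards [h₁] with x hx using mul_nonneg hx χ.nonneg
  · rw [hi2]
    refine mul_nonneg hε.le (integral_nonneg_of_ae ?_)
    filter_upwards [h₂] with x hx using mul_nonneg hx χ.nonneg
  · filter_upwards [ae_integrableOn_rpow hsol hτ (R + τ)] with s hs hsI h0
    have e1 := hint (fun _ => 1) hsI
    simp only [mul_one] at e1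
    have h := moment_rpow_le hpq (aestronglyMeasurable_slice hsol (timeInterval_subset hτ hsI))
      (hmem s hsI (hs hsI)) (ae_eq_zero_of_cone hsol hcone s₀ (timeInterval_subset hτ hsI))
      (φ := fun _ => 1) continuous_const (fun _ => zero_le_one) (by simpa [← e1] using h0)
    simp only [mul_one, Real.one_rpow] at h
    rw [e1, hN hsI]
    simpa using h
  · filter_upwards [ae_integrableOn_rpow hsol hτ (R + τ)] with s hs hsI
    have e1 := hint radialExp hsI
    have h3 := hexp s hsI
    simp only [hg0'] at h3
    have hI0 : 0 ≤ ∫ x in Metric.closedBall 0 R, fn u₀ x * radialExp x := by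
      refine integral_nonneg_of_ae ?_
      filter_upwards [ae_restrict_of_ae h₀] with x hx using mul_nonneg hx (hΦ0 x)
    have h4 : 0 ≤ ε * (∫ x in Metric.closedBall 0 R, fn u₀ x * radialExp x) / (2 * (1 + β))
          * Real.exp s := by positivity
    rw [e1] at h3
    have h := moment_rpow_le hpq (aestronglyMeasurable_slice hsol (timeInterval_subset hτ hsI))
      (hmem s hsI (hs hsI)) (ae_eq_zero_of_cone hsol hcone s₀ (timeInterval_subset hτ hsI))
      hΦ.continuous hΦ0 (h4.trans h3)
    rw [hN hsI]
    refine (Real.rpow_le_rpow h4 h3 hp0.le).trans (h.trans ?_)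
    have h5 := hC (R + s) (by linarith [hsI.1])
    have h6 : 0 ≤ ∫ x in Metric.closedBall (0 : Space n) (R + s), radialExp x ^ q :=
      integral_nonneg fun x => Real.rpow_nonneg (hΦ0 x) q
    refine mul_le_mul_of_nonneg_left (Real.rpow_le_rpow h6 h5 (by linarith)) ?_
    exact integral_nonneg fun x => by positivity

end Solution

/-! ### The Kato type iteration -/

/-- Allows comparable weights to be exchanged whatever the sign of the exponent. -/
theorem rpow_abs_le_rpow {x c : ℝ} (hc : 1 ≤ c) (h1 : c⁻¹ ≤ x) (h2 : x ≤ c) (a : ℝ) :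
    c ^ (-|a|) ≤ x ^ a := by
  have hc0 : 0 < c := by linarith
  have hx : 0 < x := lt_of_lt_of_le (by positivity) h1
  rcases le_total 0 a with h | h
  · rw [abs_of_nonneg h, Real.rpow_neg hc0.le, ← Real.inv_rpow hc0.le]
    exact Real.rpow_le_rpow (by positivity) h1 h
  · rw [abs_of_nonpos h, neg_neg]
    exact Real.rpow_le_rpow_of_nonpos hx h2 h

/-- A sequence with `a_{k+1} ≥ B 8^{-k} a_k^p` whose first term is large grows geometrically. -/
theorem geometric_le_of_superlinear {p B : ℝ} (hp : 1 < p) (hB : 0 ≤ B) {a : ℕ → ℝ} (h0 : 0 < a 0)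
    (hstep : ∀ k, B * (1 / 8) ^ k * a k ^ p ≤ a (k + 1))
    (hlarge : (8 : ℝ) ^ (1 / (p - 1)) ≤ B * a 0 ^ (p - 1)) (k : ℕ) :
    a 0 * ((8 : ℝ) ^ (1 / (p - 1))) ^ k ≤ a k := by
  -- The ratio is fixed by μ^(p-1) = 8: then (μ^k)^p = μ^k 8^k, and the surplus 8^k cancels the loss
  -- 8^{-k} of each step.
  set μ : ℝ := (8 : ℝ) ^ (1 / (p - 1)) with hμ
  have hp1 : 0 < p - 1 := by linarith
  have hμ0 : 0 < μ := by positivity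
  have hμp : μ ^ p = μ * 8 := by
    have h1 : μ ^ (p - 1) = 8 := by
      rw [hμ, ← Real.rpow_mul (by norm_num), one_div, inv_mul_cancel₀ hp1.ne', Real.rpow_one]
    have h2 := Real.rpow_add hμ0 1 (p - 1)
    rw [h1, Real.rpow_one] at h2
    rw [← h2]
    congr 1
    ring
  have ha0 : a 0 ^ p = a 0 ^ (p - 1) * a 0 := by
    have h2 := Real.rpow_add h0 (p - 1) 1
    rw [Real.rpow_one] at h2
    rw [← h2]
    congr 1
    ring
  induction k with
  | zero => simp
  | succ k ih =>
    refine le_trans ?_ (hstep k)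
    have h1 : (a 0 * μ ^ k) ^ p ≤ a k ^ p := Real.rpow_le_rpow (by positivity) ih (by linarith)
    have h2 : (a 0 * μ ^ k) ^ p = a 0 ^ (p - 1) * a 0 * (μ ^ k * 8 ^ k) := by
      rw [Real.mul_rpow h0.le (by positivity), ha0, ← Real.rpow_natCast, ← Real.rpow_mul hμ0.le,
        mul_comm (k : ℝ) p, Real.rpow_mul hμ0.le, hμp, Real.rpow_natCast, mul_pow, Real.rpow_natCast]
    calc a 0 * μ ^ (k + 1) = μ * (a 0 * μ ^ k) := by ring
      _ ≤ (B * a 0 ^ (p - 1)) * (a 0 * μ ^ k) := by gcongr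
      _ = B * (1 / 8) ^ k * (a 0 ^ (p - 1) * a 0 * (μ ^ k * 8 ^ k)) := by
          have : ((1 : ℝ) / 8) ^ k * 8 ^ k = 1 := by rw [← mul_pow]; norm_num
          linear_combination (-(B * a 0 ^ (p - 1) * a 0 * μ ^ k)) * this
      _ ≤ B * (1 / 8) ^ k * a k ^ p := by
          rw [← h2]
          gcongr

/-- A Kato type lemma for `β U''' + U'' = N`, with `N ≥ A₁ (1 + t)^{-σ} U^p` and
`N ≥ A₂ E (1 + t)^κ`. -/
theorem exists_kato_bound {β p σ κ A₁ A₂ : ℝ} (hβ : 0 < β) (hp : 1 < p) (hA₁ : 0 < A₁)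
    (hA₂ : 0 < A₂) :
    ∃ K : ℝ, 0 < K ∧ ∀ (E T : ℝ), 0 < E → 1 ≤ T → ∀ U U₁ U₂ N : ℝ → ℝ,
      (∀ t ∈ Icc 0 (2 * T), HasDerivWithinAt U (U₁ t) (Icc 0 (2 * T)) t) →
      (∀ t ∈ Icc 0 (2 * T), HasDerivWithinAt U₁ (U₂ t) (Icc 0 (2 * T)) t) →
      0 ≤ U 0 → 0 ≤ U₁ 0 → 0 ≤ U₂ 0 → IntegrableOn N (Icc 0 (2 * T)) → (∀ s, 0 ≤ N s) →
      (∀ t ∈ Icc 0 (2 * T), β * U₂ t + U₁ t = β * U₂ 0 + U₁ 0 + ∫ s in (0 : ℝ)..t, N s) →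
      (∀ᵐ s, s ∈ Icc 0 (2 * T) → 0 ≤ U s → A₁ * (1 + s) ^ (-σ) * U s ^ p ≤ N s) →
      (∀ᵐ s, s ∈ Icc 0 (2 * T) → A₂ * E * (1 + s) ^ κ ≤ N s) →
      E ^ (p - 1) * T ^ ((p - 1) * (κ + 2) + 2 - σ) ≤ K := by
  -- For h = Tx/2 with x ≤ 1 ≤ T one has h³ = T³x³/8 and 3(2β + h) ≤ 3(2β + 1)T; hence 24 = 8 · 3.
  -- The powers of 3 below come from T/3 ≤ 1 + s ≤ 3T on [T/2, 2T].
  set d : ℝ := 24 * (2 * β + 1) with hd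
  have hd0 : 0 < d := by positivity
  set D₁ : ℝ := A₂ * 3 ^ (-|κ|) / d with hD₁
  set D₂ : ℝ := A₁ * 3 ^ (-|-σ|) / d with hD₂
  have hD₁0 : 0 < D₁ := by positivity
  have hD₂0 : 0 < D₂ := by positivity
  refine ⟨8 ^ (1 / (p - 1)) / (D₂ * D₁ ^ (p - 1)), by positivity, ?_⟩
  intro E T hE hT U U₁ U₂ N hU hU₁ h0 h1 h2 hNi hN0 heq hlow1 hlow2
  have hT0 : 0 < T := by linarith
  have hnonneg : ∀ t ∈ Icc 0 (2 * T), 0 ≤ U₁ t := by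
    refine deriv_nonneg_of_second_order hβ hU₁ h1 fun t ht => ?_
    rw [heq t ht]
    have : 0 ≤ ∫ s in (0 : ℝ)..t, N s := intervalIntegral.integral_nonneg ht.1 fun s _ => hN0 s
    positivity
  have hmono : MonotoneOn U (Icc 0 (2 * T)) := monotoneOn_Icc_of_hasDerivWithinAt hU hnonneg
  have h00 : (0 : ℝ) ∈ Icc 0 (2 * T) := ⟨le_rfl, by linarith⟩
  have hU0 : ∀ t ∈ Icc 0 (2 * T), 0 ≤ U t := fun t ht => h0.trans (hmono h00 ht ht.1)
  -- growth on a subinterval on which `N` is bounded below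
  have hgrow : ∀ a h γ : ℝ, 0 ≤ a → 0 ≤ h → a + h ≤ 2 * T → 0 ≤ γ →
      (∀ᵐ s, s ∈ Icc a (a + h) → γ ≤ N s) → γ * (h ^ 3 / (3 * (2 * β + h))) ≤ U (a + h) := by
    intro a h γ ha hh hah hγ hγN
    have hsub : Icc a (a + h) ⊆ Icc 0 (2 * T) := Icc_subset_Icc ha hah
    have haI : a ∈ Icc 0 (2 * T) := ⟨ha, by linarith⟩
    refine cube_div_le_of_second_order hβ hγ hh (fun t ht => (hU t (hsub ht)).mono hsub)
      (fun t ht => (hU₁ t (hsub ht)).mono hsub) (hU0 a haI) (hnonneg a haI) fun t ht => ?_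
    have hii : ∀ {x y : ℝ}, 0 ≤ x → x ≤ y → y ≤ 2 * T → IntervalIntegrable N volume x y := by
      intro x y hx hxy hy
      rw [intervalIntegrable_iff_integrableOn_Icc_of_le hxy]
      exact hNi.mono_set (Icc_subset_Icc hx hy)
    have ht2 : t ≤ 2 * T := ht.2.trans hah
    rw [heq t (hsub ht), ← intervalIntegral.integral_add_adjacent_intervals
      (hii le_rfl ha (by linarith)) (hii ha ht.1 ht2)]
    have i1 : 0 ≤ ∫ s in (0 : ℝ)..a, N s := intervalIntegral.integral_nonneg ha fun s _ => hN0 s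
    have i2 : ∫ s in a..t, γ ≤ ∫ s in a..t, N s := by
      refine intervalIntegral.integral_mono_ae_restrict ht.1 (by simp) (hii ha ht.1 ht2) ?_
      rw [Filter.EventuallyLE, ae_restrict_iff' measurableSet_Icc]
      filter_upwards [hγN] with s hs hsI
      exact hs ⟨hsI.1, hsI.2.trans ht.2⟩
    rw [intervalIntegral.integral_const, smul_eq_mul] at i2
    have : 0 ≤ β * U₂ 0 := by positivity
    nlinarith
  have hweight : ∀ a s : ℝ, T / 2 ≤ s → s ≤ 2 * T → 3 ^ (-|a|) * T ^ a ≤ (1 + s) ^ a := by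
    intro a s hs1 hs2
    have h3 := rpow_abs_le_rpow (x := (1 + s) / T) (c := 3) (by norm_num)
      (by rw [le_div_iff₀ hT0]; linarith) (by rw [div_le_iff₀ hT0]; linarith) a
    rw [Real.div_rpow (by linarith) hT0.le, le_div_iff₀ (by positivity)] at h3
    exact h3
  have hcube : ∀ k : ℕ, T ^ 2 * (1 / 8) ^ k / d
      ≤ (T / 2 * (1 / 2) ^ k) ^ 3 / (3 * (2 * β + T / 2 * (1 / 2) ^ k)) := by
    intro k
    have hx0 : (0 : ℝ) < (1 / 2) ^ k := by positivity
    have hx1 : ((1 : ℝ) / 2) ^ k ≤ 1 := pow_le_one₀ (by norm_num) (by norm_num)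
    have hx3 : ((1 : ℝ) / 8) ^ k = ((1 / 2) ^ k) ^ 3 := by
      rw [← pow_mul, mul_comm, pow_mul]
      norm_num
    rw [hx3]
    set x : ℝ := (1 / 2) ^ k
    rw [hd, div_le_div_iff₀ (by positivity) (by positivity)]
    have h3 : 3 * (2 * β + T / 2 * x) ≤ 3 * ((2 * β + 1) * T) := by nlinarith
    calc T ^ 2 * x ^ 3 * (3 * (2 * β + T / 2 * x)) ≤ T ^ 2 * x ^ 3 * (3 * ((2 * β + 1) * T)) := by
          gcongr
      _ = _ := by ring
  -- the starting value
  have hstart : D₁ * E * T ^ (κ + 2) ≤ U T := by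
    have h3 := hgrow (T / 2) (T / 2) (A₂ * E * (3 ^ (-|κ|) * T ^ κ)) (by linarith) (by linarith)
      (by linarith) (by positivity) (by
        filter_upwards [hlow2] with s hs hsI
        refine le_trans ?_ (hs ⟨by linarith [hsI.1], by linarith [hsI.2]⟩)
        have := hweight κ s hsI.1 (by linarith [hsI.2])
        gcongr)
    rw [add_halves] at h3
    have h4 := hcube 0
    simp only [pow_zero, mul_one] at h4
    refine le_trans ?_ h3
    refine le_trans (le_of_eq ?_) (mul_le_mul_of_nonneg_left h4 (by positivity))
    rw [Real.rpow_add hT0, Real.rpow_two, hD₁]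
    ring
  -- The times increase from T towards 2T with steps (T/2) 2^{-k}. The cubic growth on each step
  -- produces the factor 8^{-k}.
  set t : ℕ → ℝ := fun k => T * (2 - (1 / 2) ^ k) with ht
  have htI : ∀ k, T ≤ t k ∧ t k ≤ 2 * T := by
    intro k
    have hx0 : (0 : ℝ) < (1 / 2) ^ k := by positivity
    have hx1 : ((1 : ℝ) / 2) ^ k ≤ 1 := pow_le_one₀ (by norm_num) (by norm_num)
    constructor <;> simp only [ht] <;> nlinarith
  have ht0 : t 0 = T := by
    simp only [ht, pow_zero]
    ring
  have htI' : ∀ k, t k ∈ Icc 0 (2 * T) := fun k => ⟨by linarith [(htI k).1], (htI k).2⟩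
  have hstep : ∀ k, D₂ * T ^ (2 - σ) * (1 / 8) ^ k * U (t k) ^ p ≤ U (t (k + 1)) := by
    intro k
    have hk := htI k
    have hUk := hU0 _ (htI' k)
    have e1 : t (k + 1) = t k + T / 2 * (1 / 2) ^ k := by
      simp only [ht, pow_succ]
      ring
    have h3 := hgrow (t k) (T / 2 * (1 / 2) ^ k) (A₁ * (3 ^ (-|-σ|) * T ^ (-σ)) * U (t k) ^ p)
      (by linarith) (by positivity) (by rw [← e1]; exact (htI _).2) (by positivity) (by
        filter_upwards [hlow1] with s hs hsI
        have hs2 : s ≤ 2 * T := by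
          have := hsI.2
          rw [← e1] at this
          exact this.trans (htI _).2
        have hsI' : s ∈ Icc 0 (2 * T) := ⟨by linarith [hsI.1], hs2⟩
        refine le_trans ?_ (hs hsI' (hU0 s hsI'))
        have h4 := hweight (-σ) s (by linarith [hsI.1]) hs2
        have h5 : U (t k) ≤ U s := hmono (htI' k) hsI' hsI.1
        have h6 : U (t k) ^ p ≤ U s ^ p := Real.rpow_le_rpow hUk h5 (by linarith)
        have : 0 < 1 + s := by linarith [hsI'.1]
        gcongr)
    rw [e1]
    refine le_trans ?_ h3
    refine le_trans (le_of_eq ?_) (mul_le_mul_of_nonneg_left (hcube k) (by positivity))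
    rw [sub_eq_add_neg, Real.rpow_add hT0, Real.rpow_two, hD₂]
    ring
  have hUT : 0 < U T := lt_of_lt_of_le (by positivity) hstart
  have hsmall : D₂ * T ^ (2 - σ) * U T ^ (p - 1) < 8 ^ (1 / (p - 1)) := by
    by_contra! hcon
    -- Geometric growth of U(t_k) contradicts U(t_k) ≤ U(2T).
    have hgeo := geometric_le_of_superlinear hp (B := D₂ * T ^ (2 - σ)) (by positivity)
      (a := fun k => U (t k)) (by simpa only [ht0] using hUT) hstep (by simpa only [ht0] using hcon)
    have hμ : 1 < (8 : ℝ) ^ (1 / (p - 1)) := by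
      have : 0 < p - 1 := by linarith
      exact Real.one_lt_rpow (by norm_num) (by positivity)
    obtain ⟨k, hk⟩ := pow_unbounded_of_one_lt (U (2 * T) / U T) hμ
    rw [div_lt_iff₀ hUT] at hk
    have h3 := hgeo k
    simp only [ht0] at h3
    have h4 : U (t k) ≤ U (2 * T) := hmono (htI' k) ⟨by linarith, le_rfl⟩ (htI k).2
    linarith [mul_comm (U T) (((8 : ℝ) ^ (1 / (p - 1))) ^ k)]
  rw [le_div_iff₀ (by positivity)]
  refine le_trans ?_ hsmall.le
  have h3 : (D₁ * E * T ^ (κ + 2)) ^ (p - 1) ≤ U T ^ (p - 1) :=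
    Real.rpow_le_rpow (by positivity) hstart (by linarith)
  refine le_trans (le_of_eq ?_) (mul_le_mul_of_nonneg_left h3 (by positivity))
  rw [Real.mul_rpow (by positivity) (by positivity), Real.mul_rpow hD₁0.le hE.le,
    ← Real.rpow_mul hT0.le]
  have e1 : T ^ ((p - 1) * (κ + 2) + 2 - σ) = T ^ (2 - σ) * T ^ ((κ + 2) * (p - 1)) := by
    rw [← Real.rpow_add hT0]
    congr 1
    ring
  rw [e1]
  ring

/-! ### Positivity of θ and the bound for the existence time -/

/-- With q the Strauss exponent, the second root of the quadratic is -2/((n-1)q), so θ = (q -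
p)((n-1)p + 2/q). For n = 1, θ = 2 + 2p. -/
theorem theta_pos {n : ℕ} (hn : 1 ≤ n) {p : ℝ} (hp : 1 < p) (hpn : 2 ≤ n → p < straussExponent n) :
    0 < theta p n := by
  unfold theta
  rcases hn.eq_or_lt with h | h
  · subst h
    push_cast
    nlinarith
  · have h2 : (2 : ℝ) ≤ n := by exact_mod_cast h
    have hps := hpn h
    set q := straussExponent n
    have hq : 1 < q := hp.trans hps
    have h3 := (eq_straussExponent_iff h (q := q) (by linarith)).1 rfl
    have h4 : 2 + ((n : ℝ) + 1) * p - (n - 1) * p ^ 2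
        = (q - p) * (((n : ℝ) - 1) * p + 2 / q) := by
      have h5 : ((n : ℝ) + 1) = (n - 1) * q - 2 / q := by
        field_simp
        linarith
      rw [h5]
      field_simp
      ring
    rw [h4]
    have : 0 < ((n : ℝ) - 1) * p := mul_pos (by linarith) (by linarith)
    exact mul_pos (by linarith) (by positivity)

theorem setIntegral_mul_radialExp_pos {n : ℕ} (hn : 1 ≤ n) {R : ℝ} (f : L2 n)
    (hf : ∀ᵐ x, 0 ≤ f x) (hs : SupportedInBall R f) (hne : ¬ f =ᵐ[volume] 0) :
    0 < ∫ x in Metric.closedBall (0 : Space n) R, f x * radialExp x := by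
  have hΦ : ∀ x : Space n, 0 < radialExp x := fun x => by linarith [one_le_radialExp hn x]
  have h0 : 0 ≤ᵐ[volume.restrict (Metric.closedBall (0 : Space n) R)]
      fun x => f x * radialExp x := by
    filter_upwards [ae_restrict_of_ae hf] with x hx using mul_nonneg hx (hΦ x).le
  have hi : IntegrableOn (fun x => f x * radialExp x) (Metric.closedBall (0 : Space n) R) :=
    ((((Lp.memLp f).locallyIntegrable (by norm_num)).integrableOn_isCompact
      (isCompact_closedBall _ _))).mul_continuousOn (contDiff_radialExp hn).continuous.continuousOn
      (isCompact_closedBall _ _)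
  refine lt_of_le_of_ne (integral_nonneg_of_ae h0) fun h => hne ?_
  have h1 := (integral_eq_zero_iff_of_nonneg_ae h0 hi).1 h.symm
  rw [Filter.EventuallyEq, ae_restrict_iff' measurableSet_closedBall] at h1
  unfold SupportedInBall at hs
  filter_upwards [h1, hs] with x hx1 hx2
  by_cases hx : x ∈ Metric.closedBall (0 : Space n) R
  · exact (mul_eq_zero.1 (hx1 hx)).resolve_right (hΦ x).ne'
  · exact hx2 hx

/-- An energy solution supported in the light cone, if it exists up to time `2T`, forces
`ε^{p(p-1)} T^{θ/2}` to be bounded. -/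
theorem exists_existence_time_bound {n : ℕ} (hn : 1 ≤ n) {p β R : ℝ} (hp : 1 < p) (hβ : 0 < β)
    (hR : 0 < R) (u₀ : Sobolev n 2) (u₁ : Sobolev n 1) (u₂ : L2 n)
    (h₀ : ∀ᵐ x, 0 ≤ fn u₀ x) (h₁ : ∀ᵐ x, 0 ≤ fn u₁ x) (h₂ : ∀ᵐ x, 0 ≤ u₂ x)
    (s₀ : SupportedInBall R (fn u₀)) (hu₀ : ¬ fn u₀ =ᵐ[volume] 0) :
    ∃ K : ℝ, 0 < K ∧ ∀ (ε T : ℝ), 0 < ε → 1 ≤ T → ∀ (S : ℝ≥0∞) (u : ℝ → Space n → ℝ),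
      IsEnergySolution β p ε u₀ u₁ u₂ S u → SupportedInCone R S u → 2 * T ∈ timeInterval S →
      ε ^ (p * (p - 1)) * T ^ (theta p n / 2) ≤ K := by
  have hp1 : 0 < p - 1 := by linarith
  have hp0 : 0 < p := by linarith
  have hpq := Real.HolderConjugate.conjExponent hp
  set q := p.conjExponent
  -- This identity makes the growth e^{ps} of the p-th power of the eigenfunction moment cancel
  -- against the Hölder factor e^{q(p-1)s}.
  have hqp : q * (p - 1) = p := by
    have := hpq.sub_one_mul_conj
    linarith
  obtain ⟨C, hC0, hC⟩ := exists_integral_radialExp_rpow_le hn hpq.symm.pos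
  set J : ℝ := ∫ x in Metric.closedBall (0 : Space n) R, fn u₀ x * radialExp x with hJ
  have hJ0 : 0 < J := setIntegral_mul_radialExp_pos hn _ h₀ s₀ hu₀
  set κ : ℝ := ((n : ℝ) - 1) * (1 - p / 2) with hκ
  set v : ℝ := (volume : Measure (Space n)).real (Metric.ball 0 1) with hv
  have hv0 : 0 < v :=
    ENNReal.toReal_pos (Metric.measure_ball_pos _ _ one_pos).ne' measure_ball_lt_top.ne
  -- A₁ absorbs the volume of B_{R+s} through R + s ≤ (1 + R)(1 + s); in A₂ the factor (1 + R)^|κ|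
  -- trades 1 + R + s for 1 + s.
  set A₁ : ℝ := (((1 + R) ^ n * v) ^ (p - 1))⁻¹ with hA₁
  set A₂ : ℝ := (J / (2 * (1 + β))) ^ p / (C ^ (p - 1) * Real.exp (p * R) * (1 + R) ^ |κ|) with hA₂
  have hA₁0 : 0 < A₁ := by positivity
  have hA₂0 : 0 < A₂ := by positivity
  obtain ⟨K, hK0, hK⟩ := exists_kato_bound (σ := n * (p - 1)) (κ := κ) hβ hp hA₁0 hA₂0
  refine ⟨K, hK0, fun ε T hε hT S u hu hcone hTS => ?_⟩
  obtain ⟨hS, V₂, V₁, V₀, hsol⟩ := hu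
  obtain ⟨U, U₁, U₂, N, hU, hU₁, i0, i1, i2, hNi, hN0, heq, hlow1, hlow2⟩ :=
    exists_mean_inequalities hn hp hβ hR hε hpq hC h₀ h₁ h₂ s₀ hS hsol hcone hTS
  have hmain := hK (ε ^ p) T (by positivity) hT U U₁ U₂ N hU hU₁ i0 i1 i2 hNi hN0 heq ?_ ?_
  · rw [← Real.rpow_mul hε.le] at hmain
    have e1 : (p - 1) * (κ + 2) + 2 - n * (p - 1) = theta p n / 2 := by
      rw [hκ, theta]
      ring
    rwa [e1] at hmain
  · filter_upwards [hlow1] with s hs hsI hUs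
    have hs0 := hsI.1
    have h3 := hs hsI hUs
    have h4 : volume.real (Metric.closedBall (0 : Space n) (R + s)) = (R + s) ^ n * v := by
      rw [Measure.addHaar_real_closedBall _ _ (by positivity), finrank_euclideanSpace_fin]
    have h5 : ((R + s) ^ n * v) ^ (p - 1) ≤ ((1 + R) ^ n * v) ^ (p - 1) * (1 + s) ^ (n * (p - 1)) := by
      have e1 : (1 + s) ^ ((n : ℝ) * (p - 1)) = ((1 + s) ^ n) ^ (p - 1) := by
        rw [Real.rpow_mul (by positivity), Real.rpow_natCast]
      rw [e1, ← Real.mul_rpow (by positivity) (by positivity)]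
      refine Real.rpow_le_rpow (by positivity) ?_ hp1.le
      have e2 : (1 + R) ^ n * v * (1 + s) ^ n = ((1 + R) * (1 + s)) ^ n * v := by
        rw [mul_pow]
        ring
      rw [e2]
      gcongr
      nlinarith
    rw [h4] at h3
    have h6 := h3.trans (mul_le_mul_of_nonneg_left h5 (hN0 s))
    rw [hA₁, Real.rpow_neg (by positivity)]
    have hP : 0 < ((1 + R) ^ n * v) ^ (p - 1) * (1 + s) ^ ((n : ℝ) * (p - 1)) := by positivity
    rw [← mul_inv, inv_mul_le_iff₀ hP]
    linarith
  · filter_upwards [hlow2] with s hs hsI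
    have hs0 := hsI.1
    have h3 := hs hsI
    have hx : 0 < 1 + (R + s) := by positivity
    have e1 : (ε * J / (2 * (1 + β)) * Real.exp s) ^ p
        = (J / (2 * (1 + β))) ^ p * ε ^ p * Real.exp (p * s) := by
      have : ε * J / (2 * (1 + β)) * Real.exp s = (J / (2 * (1 + β))) * ε * Real.exp s := by ring
      rw [this, Real.mul_rpow (by positivity) (by positivity),
        Real.mul_rpow (by positivity) hε.le, ← Real.exp_mul, mul_comm s p]
    have e2 : (C * (1 + (R + s)) ^ (((n : ℝ) - 1) * (1 - q / 2)) * Real.exp (q * (R + s))) ^ (p - 1)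
        = C ^ (p - 1) * (Real.exp (p * R) * Real.exp (p * s)) * ((1 + (R + s)) ^ κ)⁻¹ := by
      rw [Real.mul_rpow (by positivity) (by positivity), Real.mul_rpow (by positivity)
        (by positivity), ← Real.exp_mul, ← Real.rpow_mul hx.le, ← Real.rpow_neg hx.le,
        ← Real.exp_add]
      have a1 : ((n : ℝ) - 1) * (1 - q / 2) * (p - 1) = -κ := by
        rw [hκ]
        linear_combination (-((n : ℝ) - 1) / 2) * hqp
      have a2 : q * (R + s) * (p - 1) = p * R + p * s := by
        linear_combination (R + s) * hqp
      rw [a1, a2]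
      ring
    rw [e1, e2] at h3
    have h4 : (1 + s) ^ κ ≤ (1 + R) ^ |κ| * (1 + (R + s)) ^ κ := by
      have h5 := rpow_abs_le_rpow (x := (1 + (R + s)) / (1 + s)) (c := 1 + R) (by linarith)
        (by
          rw [le_div_iff₀ (by positivity), inv_mul_le_iff₀ (by positivity)]
          nlinarith) (by
          rw [div_le_iff₀ (by positivity)]
          nlinarith) κ
      rw [Real.div_rpow (by positivity) (by positivity), le_div_iff₀ (by positivity),
        Real.rpow_neg (by positivity), inv_mul_le_iff₀ (by positivity)] at h5
      exact h5
    have hE := Real.exp_pos (p * s)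
    have hxκ : 0 < (1 + (R + s)) ^ κ := by positivity
    have h5 : (J / (2 * (1 + β))) ^ p * ε ^ p * (1 + (R + s)) ^ κ
        ≤ N s * (C ^ (p - 1) * Real.exp (p * R)) := by
      have h6 := mul_le_mul_of_nonneg_right h3 (mul_nonneg hxκ.le (inv_pos.2 hE).le)
      have e3 : (J / (2 * (1 + β))) ^ p * ε ^ p * Real.exp (p * s)
          * ((1 + (R + s)) ^ κ * (Real.exp (p * s))⁻¹)
          = (J / (2 * (1 + β))) ^ p * ε ^ p * (1 + (R + s)) ^ κ := by field_simp
      have e4 : N s * (C ^ (p - 1) * (Real.exp (p * R) * Real.exp (p * s))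
          * ((1 + (R + s)) ^ κ)⁻¹) * ((1 + (R + s)) ^ κ * (Real.exp (p * s))⁻¹)
          = N s * (C ^ (p - 1) * Real.exp (p * R)) := by field_simp
      rwa [e3, e4] at h6
    rw [hA₂, div_mul_eq_mul_div, div_mul_eq_mul_div, div_le_iff₀ (by positivity)]
    calc (J / (2 * (1 + β))) ^ p * ε ^ p * (1 + s) ^ κ
        ≤ (J / (2 * (1 + β))) ^ p * ε ^ p * ((1 + R) ^ |κ| * (1 + (R + s)) ^ κ) := by gcongr
      _ = (J / (2 * (1 + β))) ^ p * ε ^ p * (1 + (R + s)) ^ κ * (1 + R) ^ |κ| := by ring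
      _ ≤ N s * (C ^ (p - 1) * Real.exp (p * R)) * (1 + R) ^ |κ| := by gcongr
      _ = _ := by ring

end MGT

/-! ### The lifespan estimate -/

theorem theorem4p1 (n : ℕ) (hn : 1 ≤ n) (p : ℝ) (hp : 1 < p)
    (hpn : 2 ≤ n → p < MGT.straussExponent n)
    (β : ℝ) (hβ : 0 < β) (R : ℝ) (hR : 0 < R)
    (u₀ : MGT.Sobolev n 2) (u₁ : MGT.Sobolev n 1) (u₂ : MGT.L2 n)
    (h₀ : ∀ᵐ x, 0 ≤ MGT.fn u₀ x) (h₁ : ∀ᵐ x, 0 ≤ MGT.fn u₁ x) (h₂ : ∀ᵐ x, 0 ≤ u₂ x)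
    (s₀ : MGT.SupportedInBall R (MGT.fn u₀)) (s₁ : MGT.SupportedInBall R (MGT.fn u₁))
    (s₂ : MGT.SupportedInBall R u₂)
    (hu₀ : ¬ MGT.fn u₀ =ᵐ[volume] 0) :
    ∃ ε₀ : ℝ, 0 < ε₀ ∧ ∃ C : ℝ, 0 < C ∧ ∀ ε : ℝ, 0 < ε → ε ≤ ε₀ →
      ∀ (T : ℝ≥0∞) (u : ℝ → MGT.Space n → ℝ),
        MGT.IsEnergySolution β p ε u₀ u₁ u₂ T u → MGT.SupportedInCone R T u →
          MGT.BlowsUpInFiniteTime β p ε R u₀ u₁ u₂ T u ∧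
          MGT.lifespan β p ε R u₀ u₁ u₂ T u ≤
            ENNReal.ofReal (C * ε ^ (-(2 * p * (p - 1) / MGT.theta p n))) := by
  have hp1 : 0 < p - 1 := by linarith
  have hp0 : 0 < p := by linarith
  have hθ := MGT.theta_pos hn hp hpn
  obtain ⟨K, hK0, hK⟩ := MGT.exists_existence_time_bound hn hp hβ hR u₀ u₁ u₂ h₀ h₁ h₂ s₀ hu₀
  set θ := MGT.theta p n
  -- Chosen so that the time D ε^{-a}, with a the lifespan exponent, turns ε^{p(p-1)} T^{θ/2} into
  -- exactly K + 1 > K.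
  set D : ℝ := (K + 1) ^ (2 / θ) with hD
  have hD1 : 1 ≤ D := Real.one_le_rpow (by linarith) (by positivity)
  -- The condition ε ≤ 1 guarantees D ε^{-a} ≥ 1, as the existence bound requires; the factor 2
  -- appears because that bound assumes existence up to 2T.
  refine ⟨1, one_pos, 2 * D, by linarith, fun ε hε hε1 T u _ _ => ?_⟩
  suffices hle : MGT.lifespan β p ε R u₀ u₁ u₂ T u ≤
      ENNReal.ofReal (2 * D * ε ^ (-(2 * p * (p - 1) / θ))) from
    ⟨hle.trans_lt ENNReal.ofReal_lt_top, hle⟩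
  refine sSup_le fun S hS => ?_
  obtain ⟨-, v, hv, hcone, -⟩ := hS
  by_contra! hlt
  set a : ℝ := 2 * p * (p - 1) / θ with ha
  have ha0 : 0 < a := by positivity
  have hεa : 1 ≤ ε ^ (-a) := Real.one_le_rpow_of_pos_of_le_one_of_nonpos hε hε1 (by linarith)
  have hT1 : 1 ≤ D * ε ^ (-a) := one_le_mul_of_one_le_of_one_le hD1 hεa
  have h3 := hK ε (D * ε ^ (-a)) hε hT1 S v hv hcone
    ⟨by linarith, by rwa [← mul_assoc]⟩
  have h4 : ε ^ (p * (p - 1)) * (D * ε ^ (-a)) ^ (θ / 2) = K + 1 := by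
    rw [Real.mul_rpow (by positivity) (by positivity), hD, ← Real.rpow_mul (by positivity),
      ← Real.rpow_mul hε.le]
    have e1 : 2 / θ * (θ / 2) = 1 := by field_simp
    have e2 : -a * (θ / 2) = -(p * (p - 1)) := by
      rw [ha]
      field_simp
    rw [e1, e2, Real.rpow_one, mul_left_comm, ← Real.rpow_add hε, add_neg_cancel, Real.rpow_zero,
      mul_one]
  linarith
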